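/- **Setting.** Let $d,T\ge 1$ be integers and $B>0$, $L\ge 0$. In rounds $t=1,\dots,T$ a prompt $x_t\in\mathcal X$ and an action space $\mathcal A_t\subseteq\mathcal A$ are received; they may be deterministic, random, or depend on the past rounds. There is a feature map $\phi:\mathcal X\times\mathcal A\to\mathbb R^d$ with $\|\phi(x,a)\|_2\le 1$ and a hidden parameter $\theta_*\in\mathbb R^d$ with $\|\theta_*\|_2\le B$; put $r_\theta(x,a)=\langle\theta,\phi(x,a)\rangle$ and $r_*=r_{\theta_*}$. If the arms $a_t^1,a_t^2\in\mathcal A_t$ are chosen, the preference $y_t\in\{1,-1\}$ follows the Bradley–Terry–Luce model: given the data of the past rounds, $x_t$, $a_t^1$ and $a_t^2$, $$\mathbb P(y_t=1)=\frac{e^{r_*(x_t,a_t^1)}}{e^{r_*(x_t,a_t^1)}+e^{r_*(x_t,a_t^2)}}.$$ The prior is a probability density $p_0$ on the ball $\{\theta\in\mathbb R^d:\|\theta\|_2\le B\}$, positive there, with $|\log p_0(\theta_1)-\log p_0(\theta_2)|\le L\|\theta_1-\theta_2\|_2$ on that ball. **Algorithm FGTS.CDB** with hyperparameters $\eta,\mu$.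 Let $\sigma(z)=\log(1+e^{-z})$ and, for $j=1,2$, $$L_t^j(\theta,x,a^1,a^2,y)=\eta\,\sigma\big(y\langle\theta,\phi(x,a^1)-\phi(x,a^2)\rangle\big)-\mu\max_{a'\in\mathcal A_t}\langle\theta,\phi(x,a')-\phi(x,a^{3-j})\rangle .$$ In round $t$, draw $\theta_t^1,\theta_t^2$ independently (given the past data and $x_t,\mathcal A_t$) from the posteriors $p^j(\theta\mid S_{t-1})\propto\exp\big(-\sum_{i<t}L_i^j(\theta,x_i,a_i^1,a_i^2,y_i)\big)p_0(\theta)$, play $a_t^j\in\arg\max_{a\in\mathcal A_t}\langle\theta_t^j,\phi(x_t,a)\rangle$ (the maxima are attained; ties are broken by a fixed measurable rule), and observe $y_t$. The average dueling regret is $$\mathrm{Regret}(T)=\sum_{t=1}^T\Big[\max_{a\in\mathcal A_t}r_*(x_t,a)-\frac{r_*(x_t,a_t^1)+r_*(x_t,a_t^2)}2\Big].$$ **Theorem.** Run FGTS.CDB with $\eta=0.25$ and $\mu=1/(10e^B\sqrt T)$. (i) $\mathbb E[\mathrm{Regret}(T)]=\tilde O(d\sqrt T)$: there are constants $C$ and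 $k\in\mathbb N$ depending only on $B$ and $L$ such that, for all $d,T\ge1$ and all instances as above, $\mathbb E[\mathrm{Regret}(T)]\le C\,d\sqrt T\,(1+\log(dT))^k$. (ii) If $d\le 2B\big(L+\frac{\sqrt T}{5e^B}+\frac T2\big)$ (in particular whenever $T\ge d/B$), then $$\mathbb E[\mathrm{Regret}(T)]\le 10e^Bd\sqrt T\Big[2-\frac{\log p_0(\theta_*)}d+\log\Big(\frac L{\sqrt d}+\frac1{5e^B}\sqrt{\frac Td}+\frac T{2\sqrt d}\Big)\Big].$$ -/

import Mathlib

open MeasureTheory ProbabilityTheory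

noncomputable section

namespace DuelingBandit

/-- Parameters and feature vectors: `ℝ^d` with the Euclidean norm. -/
abbrev Vec (d : ℕ) : Type := EuclideanSpace ℝ (Fin d)

/-- The data recorded in one round: the prompt, the two arms (arm `0` and arm `1`), and the
preference, `true` (that is `y = 1`) if arm `0` is preferred and `false` (`y = -1`) if arm `1` is. -/
abbrev Record (𝒳 𝒜 : Type*) : Type _ := 𝒳 × (Fin 2 → 𝒜) × Bool

/-- The preference as a real number `1` or `-1`. -/
def sgn (y : Bool) : ℝ := if y then 1 else -1

/-- The logistic loss `σ(z) = log (1 + exp (-z))`. -/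
def logistic (z : ℝ) : ℝ := Real.log (1 + Real.exp (-z))

section Model

variable {𝒳 𝒜 : Type*} {d : ℕ}

/-- The linear reward `r_θ(x, a) = ⟨θ, φ(x, a)⟩`. -/
def reward (φ : 𝒳 → 𝒜 → Vec d) (θ : Vec d) (x : 𝒳) (a : 𝒜) : ℝ := inner ℝ θ (φ x a)

/-- The Bradley-Terry-Luce probability that arm `a 0` is preferred over arm `a 1`. -/
def btl (φ : 𝒳 → 𝒜 → Vec d) (θ : Vec d) (x : 𝒳) (a : Fin 2 → 𝒜) : ℝ :=
  Real.exp (reward φ θ x (a 0)) /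
    (Real.exp (reward φ θ x (a 0)) + Real.exp (reward φ θ x (a 1)))

/-- The largest reward over the action space `A`. -/
def maxReward (φ : 𝒳 → 𝒜 → Vec d) (A : Set 𝒜) (θ : Vec d) (x : 𝒳) : ℝ :=
  ⨆ a : A, reward φ θ x a

/-- The likelihood function `L^j` with action space `A`: logistic loss minus the Feel-Good
exploration term, in which `1 - j` is the index of the adversarial arm. -/
def loss (η μ : ℝ) (φ : 𝒳 → 𝒜 → Vec d) (A : Set 𝒜) (j : Fin 2) (θ : Vec d) (r : Record 𝒳 𝒜) :
    ℝ :=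
  η * logistic (sgn r.2.2 * inner ℝ θ (φ r.1 (r.2.1 0) - φ r.1 (r.2.1 1)))
    - μ * ⨆ a' : A, inner ℝ θ (φ r.1 a' - φ r.1 (r.2.1 (1 - j)))

/-- The prior: the distribution on the ball of radius `B` with Lebesgue density `p₀`. -/
def prior (B : ℝ) (p₀ : Vec d → ℝ) : Measure (Vec d) :=
  (volume.restrict (Metric.closedBall 0 B)).withDensity fun θ => ENNReal.ofReal (p₀ θ)

/-- The posterior `p^j(· | S)` after the `t` rounds recorded in `S`:
the probability measure proportional to `exp (- ∑ i, L^j(θ, x_i, a_i^1, a_i^2, y_i)) p₀(θ) dθ`.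
The action space of round `i` is `act i x_i`. -/
def fgPosterior (η μ B : ℝ) (p₀ : Vec d → ℝ) (φ : 𝒳 → 𝒜 → Vec d) (act : ℕ → 𝒳 → Set 𝒜)
    (j : Fin 2) {t : ℕ} (S : Fin t → Record 𝒳 𝒜) : Measure (Vec d) :=
  (prior B p₀).tilted fun θ => -∑ i : Fin t, loss η μ φ (act i (S i).1) j θ (S i)

/-- `p₀` is a positive probability density on the ball of radius `B` whose logarithm is
`L`-Lipschitz there. -/
structure IsLipschitzPrior (B L : ℝ) (p₀ : Vec d → ℝ) : Prop where
  pos : ∀ θ, ‖θ‖ ≤ B → 0 < p₀ θ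
  isProb : IsProbabilityMeasure (prior B p₀)
  lipschitz : ∀ θ₁ θ₂, ‖θ₁‖ ≤ B → ‖θ₂‖ ≤ B →
    |Real.log (p₀ θ₁) - Real.log (p₀ θ₂)| ≤ L * ‖θ₁ - θ₂‖

/-- `sel t j x` is an argmax rule for round `t` and sampler `j`: it picks, for every parameter
`θ` of the ball, an arm of the action space `act t x` with the largest reward `r_θ(x, ·)`. Ties are
broken in an arbitrary measurable way. -/
structure IsArgmaxRule [MeasurableSpace 𝒳] [MeasurableSpace 𝒜] (B : ℝ) (φ : 𝒳 → 𝒜 → Vec d)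
    (act : ℕ → 𝒳 → Set 𝒜) (sel : ℕ → Fin 2 → 𝒳 → Vec d → 𝒜) : Prop where
  measurable : ∀ t j, Measurable fun p : 𝒳 × Vec d => sel t j p.1 p.2
  mem : ∀ t j x θ, ‖θ‖ ≤ B → sel t j x θ ∈ act t x
  max : ∀ t j x θ, ‖θ‖ ≤ B → ∀ a ∈ act t x, reward φ θ x a ≤ reward φ θ x (sel t j x θ)

variable {Ω : Type*}

/-- The two arms `a_t^1, a_t^2` pulled in round `t`. -/
def arms (sel : ℕ → Fin 2 → 𝒳 → Vec d → 𝒜) (X : ℕ → Ω → 𝒳) (θ : ℕ → Fin 2 → Ω → Vec d)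
    (t : ℕ) (ω : Ω) : Fin 2 → 𝒜 :=
  fun j => sel t j (X t ω) (θ t j ω)

/-- The data collected in the rounds before round `t` (rounds are numbered from `0`). -/
def hist (sel : ℕ → Fin 2 → 𝒳 → Vec d → 𝒜) (X : ℕ → Ω → 𝒳) (θ : ℕ → Fin 2 → Ω → Vec d)
    (Y : ℕ → Ω → Bool) (t : ℕ) (ω : Ω) : Fin t → Record 𝒳 𝒜 :=
  fun i => (X i ω, arms sel X θ i ω, Y i ω)

/-- The cumulative average regret of `T` rounds. -/
def regret (φ : 𝒳 → 𝒜 → Vec d) (act : ℕ → 𝒳 → Set 𝒜) (θs : Vec d)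
    (sel : ℕ → Fin 2 → 𝒳 → Vec d → 𝒜) (X : ℕ → Ω → 𝒳) (θ : ℕ → Fin 2 → Ω → Vec d)
    (T : ℕ) (ω : Ω) : ℝ :=
  ∑ t ∈ Finset.range T,
    (maxReward φ (act t (X t ω)) θs (X t ω)
      - (reward φ θs (X t ω) (arms sel X θ t ω 0) + reward φ θs (X t ω) (arms sel X θ t ω 1)) / 2)

/-- The random prompts `X`, sampled parameters `θ` and preferences `Y` on the probability space
`(Ω, P)` are a run of `T` rounds of FGTS.CDB, with hyperparameters `η` and `μ`, in the environment
with true parameter `θs`. In each round: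
* given the past data and the current prompt, the two parameters are independent draws from
  the two posteriors;
* given the past data, the current prompt and the two arms, the preference follows the
  Bradley-Terry-Luce model.
Nothing is asked of the law of the prompts: they may be deterministic, random, or chosen
adversarially depending on the past. -/
structure IsRun [MeasurableSpace 𝒳] [MeasurableSpace 𝒜] [MeasurableSpace Ω]
    (P : Measure Ω) [IsProbabilityMeasure P] (T : ℕ) (η μ B : ℝ) (p₀ : Vec d → ℝ)
    (φ : 𝒳 → 𝒜 → Vec d) (act : ℕ → 𝒳 → Set 𝒜) (θs : Vec d)
    (sel : ℕ → Fin 2 → 𝒳 → Vec d → 𝒜) (X : ℕ → Ω → 𝒳) (θ : ℕ → Fin 2 → Ω → Vec d)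
    (Y : ℕ → Ω → Bool) : Prop where
  measurable_X : ∀ t < T, Measurable (X t)
  measurable_θ : ∀ t < T, ∀ j, Measurable (θ t j)
  measurable_Y : ∀ t < T, Measurable (Y t)
  sample : ∀ t < T, ∀ᵐ ω ∂P,
    condDistrib (fun ω => (θ t 0 ω, θ t 1 ω)) (fun ω => (hist sel X θ Y t ω, X t ω)) P
        (hist sel X θ Y t ω, X t ω)
      = (fgPosterior η μ B p₀ φ act 0 (hist sel X θ Y t ω)).prod
          (fgPosterior η μ B p₀ φ act 1 (hist sel X θ Y t ω))
  preference : ∀ t < T, ∀ᵐ ω ∂P,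
    condDistrib (Y t) (fun ω => (hist sel X θ Y t ω, X t ω, arms sel X θ t ω)) P
        (hist sel X θ Y t ω, X t ω, arms sel X θ t ω) {true}
      = ENNReal.ofReal (btl φ θs (X t ω) (arms sel X θ t ω))

end Model

end DuelingBandit

end

noncomputable section

namespace DuelingBandit

/-! The proof is a potential argument, carried out for each sampler `j` separately. The potential is
the logarithm of the partition function `∫ exp (-(cumLoss θ - cumLoss θs))` under the prior. It
starts at `0`, and its increments are log-Laplace transforms of the one-round excess loss under the
current posterior (`logPartition_succ`).

From below, the cumulative loss is Lipschitz with constant `K = T (1/2 + 2 μ)`, and a log-Lipschitz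
prior puts enough mass near `θs`. So the final potential is at least `log (p₀ θs) - d - d log ((L +
K) / √d)` on every history (`le_log_integral_exp`).

From above, averaging an increment over the preference brings in the Hellinger affinity of two
Bernoulli laws. It produces `-κ ⟨θ' - θs, w⟩²` with `κ = exp (-2B) / 64`, plus `μ` times the
feel-good gain and an error of order `(μ B)²` (`mean_log_integral_exp_le`). Given the past, the two
parameters are independent, so the opponent's arm can be frozen while `θ` is drawn from the
posterior of sampler `j`. Feel-good gain plus regret of arm `j` is then the correlation `E ⟨θ - θs,
f θ - v⟩`, where `f θ` is the feature of the played arm and `v` that of the opponent. Decoupling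
(`integral_inner_le_decoupled`) bounds it by the same square with an independent copy `θ'`, which
cancels, at the price `d μ² / (4 κ)` (`integral_feelGood_add_regret_le`).

Summing over rounds, the errors add up to at most `d` since `T μ² = exp (-2B) / 100`. Dividing by
`μ` gives (ii). For (i), `-log (p₀ θs) / d` is bounded in terms of `B` and `L` because the prior has
mass one; if `d` violates the condition of (ii), then `d > B T` and the trivial bound `2 B T`
suffices. -/

/-! ### Hellinger affinity of logistic preferences -/

lemma one_add_sq_div_two_le_cosh (x : ℝ) : 1 + x ^ 2 / 2 ≤ Real.cosh x := by
  have h : Real.cosh x = 1 + 2 * Real.sinh (x / 2) ^ 2 := by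
    have h1 := Real.cosh_two_mul (x / 2)
    have h2 := Real.cosh_sq (x / 2)
    rw [show 2 * (x / 2) = x by ring] at h1
    linarith
  have h3 : (x / 2) ^ 2 ≤ Real.sinh (x / 2) ^ 2 := by
    rw [sq_le_sq]
    rcases le_total 0 (x / 2) with h | h
    · rw [abs_of_nonneg h, abs_of_nonneg (Real.sinh_nonneg_iff.2 h)]
      exact Real.self_le_sinh_iff.2 h
    · rw [abs_of_nonpos h, abs_of_nonpos (Real.sinh_nonpos_iff.2 h)]
      linarith [Real.sinh_le_self_iff.2 h]
  rw [h]
  nlinarith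

lemma cosh_le_exp_of_abs_le {x b : ℝ} (h : |x| ≤ b) : Real.cosh x ≤ Real.exp b := by
  rw [Real.cosh_eq]
  have := Real.exp_le_exp.2 ((le_abs_self x).trans h)
  have := Real.exp_le_exp.2 ((neg_le_abs x).trans h)
  linarith

lemma one_add_exp_neg (z : ℝ) :
    1 + Real.exp (-z) = Real.exp (-(z / 2)) * (2 * Real.cosh (z / 2)) := by
  rw [Real.cosh_eq, mul_div_cancel₀ _ two_ne_zero, mul_add, ← Real.exp_add, ← Real.exp_add]
  simp only [neg_add_cancel, Real.exp_zero]
  ring_nf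

/-- Splits the loss into an even part and a linear odd part, so that the two outcomes of a
comparison share the same `cosh` factor. -/
lemma logistic_eq (z : ℝ) : logistic z = Real.log (2 * Real.cosh (z / 2)) - z / 2 := by
  have := Real.cosh_pos (z / 2)
  rw [logistic, one_add_exp_neg, Real.log_mul (Real.exp_ne_zero _) (by positivity), Real.log_exp]
  ring

/-- The Hellinger affinity of two Bernoulli distributions with bounded log-odds is
separated from `1` by the squared difference of the log-odds. -/
lemma hellinger_affinity_le {z z' B : ℝ} (hz : |z| ≤ 2 * B) (hz' : |z'| ≤ 2 * B) :
    1 / (1 + Real.exp (-z')) * Real.exp (-(1 / 2) * (logistic z - logistic z'))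
      + (1 - 1 / (1 + Real.exp (-z'))) * Real.exp (-(1 / 2) * (logistic (-z) - logistic (-z')))
      ≤ 1 - Real.exp (-(2 * B)) / 32 * (z - z') ^ 2 := by
  have hC := Real.cosh_pos (z / 2)
  have hC' := Real.cosh_pos (z' / 2)
  set C := Real.cosh (z / 2) with hCdef
  set C' := Real.cosh (z' / 2) with hCdef'
  -- `R = √(C' / C)`, in exponential form so that it multiplies with the other factors.
  set R := Real.exp ((Real.log (2 * C') - Real.log (2 * C)) / 2) with hR
  have hR2 : R ^ 2 = C' / C := by
    rw [hR, ← Real.exp_nat_mul, Nat.cast_two, mul_div_cancel₀ _ two_ne_zero, Real.exp_sub,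
      Real.exp_log (by positivity), Real.exp_log (by positivity)]
    field_simp
  have e1 : 1 / (1 + Real.exp (-z')) = Real.exp (z' / 2) / (2 * C') := by
    rw [one_add_exp_neg, Real.exp_neg, ← hCdef']
    field_simp
  have e2 : 1 - 1 / (1 + Real.exp (-z')) = Real.exp (-(z' / 2)) / (2 * C') := by
    rw [e1, hCdef', Real.cosh_eq]
    field_simp
    ring
  have e3 : Real.exp (-(1 / 2) * (logistic z - logistic z')) = Real.exp ((z - z') / 4) * R := by
    rw [hR, ← Real.exp_add, logistic_eq, logistic_eq]
    congr 1; ring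
  have e4 : Real.exp (-(1 / 2) * (logistic (-z) - logistic (-z')))
      = Real.exp (-((z - z') / 4)) * R := by
    rw [hR, ← Real.exp_add, logistic_eq, logistic_eq, neg_div, neg_div, Real.cosh_neg,
      Real.cosh_neg]
    congr 1; ring
  have e5 : Real.exp (z' / 2) * Real.exp ((z - z') / 4)
      + Real.exp (-(z' / 2)) * Real.exp (-((z - z') / 4)) = 2 * Real.cosh ((z + z') / 4) := by
    rw [Real.cosh_eq, ← Real.exp_add, ← Real.exp_add, mul_div_cancel₀ _ two_ne_zero]
    ring_nf
  -- The affinity has the closed form `S = cosh ((z + z') / 4) / √(C C')`.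
  set c := Real.cosh ((z + z') / 4) with hc
  set S := R / C' * c with hS
  have hsum : 1 / (1 + Real.exp (-z')) * Real.exp (-(1 / 2) * (logistic z - logistic z'))
      + (1 - 1 / (1 + Real.exp (-z'))) * Real.exp (-(1 / 2) * (logistic (-z) - logistic (-z')))
      = S := by
    rw [e2, e1, e3, e4]
    calc _ = R / (2 * C') * (Real.exp (z' / 2) * Real.exp ((z - z') / 4)
      + Real.exp (-(z' / 2)) * Real.exp (-((z - z') / 4))) := by ring
      _ = S := by rw [e5, hS]; field_simp
  have hS2 : S ^ 2 = c ^ 2 / (C * C') := by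
    rw [hS, mul_pow, div_pow, hR2]
    field_simp
  have hc2 : c ^ 2 = (Real.cosh ((z + z') / 2) + 1) / 2 := by
    have h1 := Real.cosh_two_mul ((z + z') / 4)
    have h2 := Real.cosh_sq ((z + z') / 4)
    rw [show 2 * ((z + z') / 4) = (z + z') / 2 by ring] at h1
    rw [← hc] at h1 h2
    linarith
  have hCC : C * C' = (Real.cosh ((z + z') / 2) + Real.cosh ((z - z') / 2)) / 2 := by
    rw [show (z + z') / 2 = z / 2 + z' / 2 by ring, show (z - z') / 2 = z / 2 - z' / 2 by ring,
      Real.cosh_add, Real.cosh_sub, hCdef, hCdef']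
    ring
  have hCb : C * C' ≤ Real.exp (2 * B) := by
    rw [show 2 * B = B + B by ring, Real.exp_add]
    refine mul_le_mul (cosh_le_exp_of_abs_le ?_) (cosh_le_exp_of_abs_le ?_) hC'.le
      (Real.exp_pos _).le <;> rw [abs_div, abs_two] <;> linarith
  have hd := one_add_sq_div_two_le_cosh ((z - z') / 2)
  -- Half-angle and product formulas leave only `cosh ((z - z') / 2) - 1` in the numerator of `1 -
  -- S²`.
  have h1S : 1 - S ^ 2 ≥ (z - z') ^ 2 / 16 * Real.exp (-(2 * B)) := by
    have : 1 - S ^ 2 = (Real.cosh ((z - z') / 2) - 1) / (2 * (C * C')) := by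
      have hP : C * C' ≠ 0 := by positivity
      rw [hS2, hc2, eq_div_iff (by positivity)]
      generalize C * C' = p at hP hCC
      field_simp
      linarith
    rw [this, Real.exp_neg, ← div_eq_mul_inv, ge_iff_le, div_le_div_iff₀ (by positivity) (by positivity)]
    calc (z - z') ^ 2 / 16 * (2 * (C * C')) ≤ (z - z') ^ 2 / 16 * (2 * Real.exp (2 * B)) := by
          gcongr
      _ = ((z - z') / 2) ^ 2 / 2 * Real.exp (2 * B) := by ring
      _ ≤ _ := by gcongr; linarith
  rw [hsum]
  -- `1 - S ≥ (1 - S²) / 2`, which turns `1/16` into `1/32`.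
  nlinarith [sq_nonneg (S - 1)]

/-! ### Decoupling inequality -/

/-- Decoupling: the correlation of two random vectors is controlled by the second moment
of their inner product under independent coupling. -/
lemma integral_inner_le_decoupled {α : Type*} [MeasurableSpace α] {q : Measure α}
    [IsProbabilityMeasure q] {d : ℕ} {u w : α → Vec d} {a b lam : ℝ}
    (hu : AEStronglyMeasurable u q) (hw : AEStronglyMeasurable w q)
    (hua : ∀ᵐ x ∂q, ‖u x‖ ≤ a) (hwb : ∀ᵐ x ∂q, ‖w x‖ ≤ b) (hlam : 0 < lam) :
    ∫ x, inner ℝ (u x) (w x) ∂q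
      ≤ lam * ∫ x, ∫ y, inner ℝ (u y) (w x) ^ 2 ∂q ∂q + d / (4 * lam) := by
  have hbd : ∀ {f : α → ℝ} (C : ℝ), AEStronglyMeasurable f q → (∀ᵐ x ∂q, |f x| ≤ C) →
      Integrable f q := fun C hf h => Integrable.of_bound hf C h
  have inn : ∀ v : Vec d, AEStronglyMeasurable (fun x => inner ℝ (u x) v) q :=
    fun v => hu.inner aestronglyMeasurable_const
  have innw : ∀ v : Vec d, AEStronglyMeasurable (fun x => inner ℝ v (w x)) q :=
    fun v => aestronglyMeasurable_const.inner hw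
  have ub : ∀ v : Vec d, ∀ᵐ x ∂q, |inner ℝ (u x) v| ≤ a * ‖v‖ := fun v => by
    filter_upwards [hua] with x hx
    exact (abs_real_inner_le_norm _ _).trans (by gcongr)
  have wb : ∀ v : Vec d, ∀ᵐ x ∂q, |inner ℝ v (w x)| ≤ ‖v‖ * b := fun v => by
    filter_upwards [hwb] with x hx
    exact (abs_real_inner_le_norm _ _).trans (by gcongr)
  have uu : ∀ v v' : Vec d, Integrable (fun x => inner ℝ (u x) v * inner ℝ (u x) v') q :=
    fun v v' => hbd (a * ‖v‖ * (a * ‖v'‖)) ((inn v).mul (inn v')) (by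
      filter_upwards [ub v, ub v'] with x h1 h2
      rw [abs_mul]
      exact mul_le_mul h1 h2 (abs_nonneg _) ((abs_nonneg _).trans h1))
  have uw : ∀ v v' : Vec d, Integrable (fun x => inner ℝ (u x) v * inner ℝ v' (w x)) q :=
    fun v v' => hbd (a * ‖v‖ * (‖v'‖ * b)) ((inn v).mul (innw v')) (by
      filter_upwards [ub v, wb v'] with x h1 h2
      rw [abs_mul]
      exact mul_le_mul h1 h2 (abs_nonneg _) ((abs_nonneg _).trans h1))
  have ww : ∀ v : Vec d, Integrable (fun x => inner ℝ v (w x) ^ 2) q :=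
    fun v => hbd ((‖v‖ * b) ^ 2) ((innw v).pow 2) (by
      filter_upwards [wb v] with x h1
      rw [abs_pow]
      exact pow_le_pow_left₀ (abs_nonneg _) h1 2)
  have hint : ∀ v : Vec d, Integrable (fun x => inner ℝ (u x) v • u x) q := fun v =>
    Integrable.of_bound ((inn v).smul hu) (a * ‖v‖ * a) (by
      filter_upwards [ub v, hua] with x h1 h2
      rw [norm_smul]
      exact mul_le_mul h1 h2 (norm_nonneg _) ((abs_nonneg _).trans h1))
  -- The second-moment operator of `u`. In its eigenbasis the decoupled square becomes a diagonal
  -- form, and the claim reduces to one scalar inequality per coordinate.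
  let T : Vec d →ₗ[ℝ] Vec d :=
    { toFun := fun v => ∫ x, inner ℝ (u x) v • u x ∂q
      map_add' := fun v v' => by
        simp only [inner_add_right, add_smul]
        exact integral_add (hint v) (hint v')
      map_smul' := fun c v => by
        simp only [inner_smul_right, mul_smul, RingHom.id_apply]
        exact integral_smul _ _ }
  have hT : ∀ v v', inner ℝ (T v) v' = ∫ x, inner ℝ (u x) v * inner ℝ (u x) v' ∂q := by
    intro v v'
    rw [real_inner_comm]
    change inner ℝ v' (∫ x, inner ℝ (u x) v • u x ∂q) = _
    rw [← integral_inner (hint v)]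
    refine integral_congr_ae (.of_forall fun x => ?_)
    simp only [inner_smul_right, real_inner_comm]
  have hsymm : T.IsSymmetric := fun v v' => by
    rw [hT, real_inner_comm, hT]
    simp only [mul_comm]
  have hn : Module.finrank ℝ (Vec d) = d := by simp
  let e := hsymm.eigenvectorBasis hn
  let s := hsymm.eigenvalues hn
  have he : ∀ i, T (e i) = s i • e i := fun i => hsymm.apply_eigenvectorBasis hn i
  have hs : ∀ i, ∫ x, inner ℝ (u x) (e i) * inner ℝ (u x) (e i) ∂q = s i := fun i => by
    rw [← hT, he, inner_smul_left, real_inner_self_eq_norm_sq, e.orthonormal.1 i]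
    simp
  have hsnn : ∀ i, 0 ≤ s i := fun i => by
    rw [← hs i]
    exact integral_nonneg fun x => mul_self_nonneg _
  have hquad : ∀ x, ∫ y, inner ℝ (u y) (w x) ^ 2 ∂q = ∑ i, s i * inner ℝ (e i) (w x) ^ 2 := by
    intro x
    simp only [sq]
    rw [← hT, ← e.sum_inner_mul_inner]
    refine Finset.sum_congr rfl fun i _ => ?_
    rw [hsymm, he, inner_smul_right, real_inner_comm]
    ring
  have hexp : ∀ x, inner ℝ (u x) (w x) = ∑ i, inner ℝ (u x) (e i) * inner ℝ (e i) (w x) :=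
    fun x => (e.sum_inner_mul_inner _ _).symm
  simp only [hquad, hexp]
  rw [integral_finsetSum _ fun i _ => uw _ _,
    integral_finsetSum _ fun i _ => (ww _).const_mul _, Finset.mul_sum]
  have key : ∀ i, ∫ x, inner ℝ (u x) (e i) * inner ℝ (e i) (w x) ∂q
      ≤ lam * (∫ x, s i * inner ℝ (e i) (w x) ^ 2 ∂q) + 1 / (4 * lam) := by
    intro i
    rcases (hsnn i).eq_or_lt with h0 | hpos
    -- In a null direction `u` has almost surely no component; treated apart because the weight
    -- below divides by `s i`.
    · have hz : (fun x => inner ℝ (u x) (e i) * inner ℝ (u x) (e i)) =ᵐ[q] 0 :=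
        (integral_eq_zero_iff_of_nonneg (fun x => mul_self_nonneg _) (uu _ _)).1
          ((hs i).trans h0.symm)
      have : ∫ x, inner ℝ (u x) (e i) * inner ℝ (e i) (w x) ∂q = 0 := by
        refine integral_eq_zero_of_ae ?_
        filter_upwards [hz] with x hx
        have : inner ℝ (u x) (e i) = 0 := mul_self_eq_zero.1 hx
        simp [this]
      rw [this, ← h0]
      simp only [zero_mul, integral_zero, mul_zero, zero_add]
      positivity
    -- AM-GM weighted by the eigenvalue: since the mean of `⟨u, e i⟩²` is `s i`, its weight `1 / (4
    -- lam s i)` leaves `1 / (4 lam)` per coordinate, whence the `d`.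
    · have hrhs : lam * (∫ x, s i * inner ℝ (e i) (w x) ^ 2 ∂q) + 1 / (4 * lam)
          = ∫ x, (lam * (s i * inner ℝ (e i) (w x) ^ 2)
            + 1 / (4 * lam * s i) * (inner ℝ (u x) (e i) * inner ℝ (u x) (e i))) ∂q := by
        rw [integral_add (((ww _).const_mul _).const_mul _) ((uu _ _).const_mul _),
          integral_const_mul lam, integral_const_mul (1 / (4 * lam * s i)), hs]
        field_simp
      rw [hrhs]
      refine integral_mono (uw _ _)
        ((((ww _).const_mul _).const_mul _).add ((uu _ _).const_mul _)) fun x => ?_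
      have h4 : 0 < 4 * lam * s i := by positivity
      have : 0 ≤ (2 * lam * s i * inner ℝ (e i) (w x) - inner ℝ (u x) (e i)) ^ 2
          / (4 * lam * s i) := by positivity
      have h5 : (2 * lam * s i * inner ℝ (e i) (w x) - inner ℝ (u x) (e i)) ^ 2 / (4 * lam * s i)
        = lam * (s i * inner ℝ (e i) (w x) ^ 2)
            + 1 / (4 * lam * s i) * (inner ℝ (u x) (e i) * inner ℝ (u x) (e i))
          - inner ℝ (u x) (e i) * inner ℝ (e i) (w x) := by
        field_simp
        ring
      simp only
      linarith
  calc _ ≤ ∑ i : Fin d, (lam * (∫ x, s i * inner ℝ (e i) (w x) ^ 2 ∂q) + 1 / (4 * lam)) :=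
        Finset.sum_le_sum fun i _ => key i
    _ = _ := by
        rw [Finset.sum_add_distrib]
        simp only [Finset.sum_const, Finset.card_univ, Fintype.card_fin, nsmul_eq_mul]
        ring

/-! ### Prior mass near the true parameter -/

/-- The ball contains the cube of half-side `s / √d`. This crude bound is what puts `√d` inside the
final logarithm. -/
lemma le_volume_closedBall {d : ℕ} (hd : 1 ≤ d) (c : Vec d) {s : ℝ} (hs : 0 ≤ s) :
    ENNReal.ofReal ((2 * (s / √d)) ^ d) ≤ volume (Metric.closedBall c s) := by
  have hd0 : (0 : ℝ) < d := by exact_mod_cast hd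
  have h := Real.volume_pi_closedBall (WithLp.ofLp c) (r := s / √d) (by positivity)
  rw [Fintype.card_fin] at h
  rw [← h, ← (PiLp.volume_preserving_ofLp (Fin d)).measure_preimage
    measurableSet_closedBall.nullMeasurableSet]
  refine measure_mono fun x hx => ?_
  rw [Set.mem_preimage, Metric.mem_closedBall, dist_pi_le_iff (by positivity)] at hx
  rw [Metric.mem_closedBall, EuclideanSpace.dist_eq]
  refine Real.sqrt_le_iff.2 ⟨hs, ?_⟩
  calc ∑ i, dist (x i) (c i) ^ 2 ≤ ∑ _i : Fin d, (s / √d) ^ 2 :=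
        Finset.sum_le_sum fun i _ => pow_le_pow_left₀ dist_nonneg (hx i) 2
    _ = s ^ 2 := by
        rw [Finset.sum_const, Finset.card_univ, Fintype.card_fin, nsmul_eq_mul, div_pow,
          Real.sq_sqrt hd0.le]
        field_simp

/-- The ball lies in the cube of half-side `s`. -/
lemma volume_closedBall_le {d : ℕ} (c : Vec d) {s : ℝ} (hs : 0 ≤ s) :
    volume (Metric.closedBall c s) ≤ ENNReal.ofReal ((2 * s) ^ d) := by
  have h := Real.volume_pi_closedBall (WithLp.ofLp c) hs
  rw [Fintype.card_fin] at h
  rw [← h, ← (PiLp.volume_preserving_ofLp (Fin d)).measure_preimage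
    measurableSet_closedBall.nullMeasurableSet]
  refine measure_mono fun x hx => ?_
  rw [Set.mem_preimage, Metric.mem_closedBall, dist_pi_le_iff hs]
  intro i
  refine le_trans ?_ (Metric.mem_closedBall.1 hx)
  rw [dist_eq_norm, dist_eq_norm]
  exact PiLp.norm_apply_le (x - c) i

lemma ae_prior_norm_le {d : ℕ} (B : ℝ) (p₀ : Vec d → ℝ) : ∀ᵐ θ ∂(prior B p₀), ‖θ‖ ≤ B := by
  refine (withDensity_absolutelyContinuous _ _).ae_le ?_
  filter_upwards [ae_restrict_mem measurableSet_closedBall] with θ h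
  simpa using h

lemma IsLipschitzPrior.le_mul_exp {d : ℕ} {B L : ℝ} {p₀ : Vec d → ℝ}
    (hp : IsLipschitzPrior B L p₀) {θ₁ θ₂ : Vec d} (h₁ : ‖θ₁‖ ≤ B) (h₂ : ‖θ₂‖ ≤ B) :
    p₀ θ₁ ≤ p₀ θ₂ * Real.exp (L * ‖θ₁ - θ₂‖) := by
  have h := (le_abs_self _).trans (hp.lipschitz θ₁ θ₂ h₁ h₂)
  rw [← Real.exp_log (hp.pos θ₁ h₁), ← Real.exp_log (hp.pos θ₂ h₂), ← Real.exp_add]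
  exact Real.exp_le_exp.2 (by linarith)

/-- The density of a log-Lipschitz prior is bounded below. -/
lemma IsLipschitzPrior.neg_log_le {d : ℕ} {B L : ℝ} {p₀ : Vec d → ℝ}
    (hp : IsLipschitzPrior B L p₀) (hB : 0 < B) (hL : 0 ≤ L) {θs : Vec d} (hθs : ‖θs‖ ≤ B) :
    -Real.log (p₀ θs) ≤ 2 * B * L + d * Real.log (2 * B) := by
  have hpos := hp.pos θs hθs
  -- The prior has total mass one, while its density on the ball is at most `p₀ θs` times `exp (2 B
  -- L)`.
  have h1 : (1 : ENNReal) ≤ ENNReal.ofReal (p₀ θs * Real.exp (L * (2 * B)) * (2 * B) ^ d) := by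
    calc (1 : ENNReal) = prior B p₀ Set.univ := hp.isProb.measure_univ.symm
      _ = ∫⁻ θ in Metric.closedBall 0 B, ENNReal.ofReal (p₀ θ) := by
          rw [prior, withDensity_apply _ MeasurableSet.univ, Measure.restrict_univ]
      _ ≤ ∫⁻ _θ in Metric.closedBall (0 : Vec d) B,
            ENNReal.ofReal (p₀ θs * Real.exp (L * (2 * B))) := by
          refine setLIntegral_mono' measurableSet_closedBall fun θ hθ => ?_
          rw [mem_closedBall_zero_iff] at hθ
          refine ENNReal.ofReal_le_ofReal ((hp.le_mul_exp hθ hθs).trans ?_)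
          have := norm_sub_le θ θs
          gcongr
          linarith
      _ ≤ ENNReal.ofReal (p₀ θs * Real.exp (L * (2 * B))) * ENNReal.ofReal ((2 * B) ^ d) := by
          rw [setLIntegral_const]
          gcongr
          exact volume_closedBall_le _ hB.le
      _ = _ := (ENNReal.ofReal_mul (by positivity)).symm
  rw [ENNReal.one_le_ofReal] at h1
  have h2 := Real.log_nonneg h1
  rw [Real.log_mul (by positivity) (by positivity), Real.log_mul (by positivity) (by positivity),
    Real.log_exp, Real.log_pow] at h2
  linarith

/-- A function that decreases at most linearly around `θs` has a large exponential integral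
under a log-Lipschitz prior. -/
lemma IsLipschitzPrior.le_log_integral_exp {d : ℕ} {B L K : ℝ} {p₀ : Vec d → ℝ}
    (hp : IsLipschitzPrior B L p₀) (hd : 1 ≤ d) (hB : 0 < B) (hL : 0 ≤ L) (hK : 0 < K)
    {θs : Vec d} (hθs : ‖θs‖ ≤ B) {g : Vec d → ℝ}
    (hg : ∀ θ, ‖θ‖ ≤ B → -(K * ‖θ - θs‖) ≤ g θ)
    (hint : Integrable (fun θ => Real.exp (g θ)) (prior B p₀)) (hdK : d ≤ 2 * B * (L + K)) :
    Real.log (p₀ θs) - d - d * Real.log ((L + K) / √d)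
      ≤ Real.log (∫ θ, Real.exp (g θ) ∂(prior B p₀)) := by
  have hd0 : (0 : ℝ) < d := by exact_mod_cast hd
  have hKL : 0 < L + K := by linarith
  have := hp.isProb
  have hpos := hp.pos θs hθs
  -- This radius makes the total exponential loss `(K + L) r` equal to `d`.
  obtain ⟨r, hr⟩ : ∃ r, r = d / (L + K) := ⟨_, rfl⟩
  have hr0 : 0 < r := hr ▸ by positivity
  have hrB : r ≤ 2 * B := by rwa [hr, div_le_iff₀ hKL]
  -- `θs` may lie on the boundary, so the centre is pulled towards the origin: the ball of radius `r
  -- / 2` about `c` stays in the prior ball and within `r` of `θs`. This needs `r ≤ 2 B`, which is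
  -- `hdK`.
  obtain ⟨c, hc⟩ : ∃ c : Vec d, c = (1 - r / (2 * B)) • θs := ⟨_, rfl⟩
  have hrB' : r / (2 * B) ≤ 1 := (div_le_one (by positivity)).2 hrB
  have hcB : ‖c‖ ≤ B - r / 2 := by
    rw [hc, norm_smul, Real.norm_of_nonneg (by linarith)]
    calc (1 - r / (2 * B)) * ‖θs‖ ≤ (1 - r / (2 * B)) * B :=
          mul_le_mul_of_nonneg_left hθs (by linarith)
      _ = _ := by field_simp
  have hcs : ‖c - θs‖ ≤ r / 2 := by
    have : c - θs = -(r / (2 * B)) • θs := by rw [hc]; module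
    rw [this, norm_smul, norm_neg, Real.norm_of_nonneg (by positivity)]
    calc r / (2 * B) * ‖θs‖ ≤ r / (2 * B) * B := by gcongr
      _ = _ := by field_simp
  have hA : ∀ θ ∈ Metric.closedBall c (r / 2), ‖θ‖ ≤ B ∧ ‖θ - θs‖ ≤ r := by
    intro θ hθ
    rw [mem_closedBall_iff_norm] at hθ
    constructor
    · have := norm_add_le (θ - c) c
      rw [sub_add_cancel] at this
      linarith
    · have := norm_add_le (θ - c) (c - θs)
      rw [sub_add_sub_cancel] at this
      linarith
  have hprior : p₀ θs * Real.exp (-(L * r)) * (√d / (L + K)) ^ d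
      ≤ (prior B p₀).real (Metric.closedBall c (r / 2)) := by
    refine (ENNReal.ofReal_le_iff_le_toReal (measure_ne_top _ _)).1 ?_
    rw [prior, withDensity_apply _ measurableSet_closedBall,
      Measure.restrict_restrict measurableSet_closedBall,
      Set.inter_eq_left.2 fun θ hθ => by simpa using (hA θ hθ).1]
    calc _ = ENNReal.ofReal (p₀ θs * Real.exp (-(L * r)))
            * ENNReal.ofReal ((2 * (r / 2 / √d)) ^ d) := by
          rw [ENNReal.ofReal_mul (by positivity), hr]
          congr 3
          field_simp
          rw [Real.sq_sqrt hd0.le]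
      _ ≤ ENNReal.ofReal (p₀ θs * Real.exp (-(L * r))) * volume (Metric.closedBall c (r / 2)) := by
          gcongr
          exact le_volume_closedBall hd c (by positivity)
      _ = ∫⁻ _θ in Metric.closedBall c (r / 2), ENNReal.ofReal (p₀ θs * Real.exp (-(L * r))) := by
          rw [setLIntegral_const]
      _ ≤ _ := by
          refine setLIntegral_mono' measurableSet_closedBall fun θ hθ => ENNReal.ofReal_le_ofReal ?_
          obtain ⟨h1, h2⟩ := hA θ hθ
          have h3 := hp.le_mul_exp hθs h1
          rw [Real.exp_neg, ← div_eq_mul_inv, div_le_iff₀ (Real.exp_pos _)]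
          refine h3.trans ?_
          have := hp.pos θ h1
          rw [norm_sub_rev]
          gcongr
  have hmain : Real.exp (-(K * r)) * (p₀ θs * Real.exp (-(L * r)) * (√d / (L + K)) ^ d)
      ≤ ∫ θ, Real.exp (g θ) ∂(prior B p₀) := by
    calc _ ≤ Real.exp (-(K * r)) * (prior B p₀).real (Metric.closedBall c (r / 2)) := by gcongr
      _ = ∫ _θ in Metric.closedBall c (r / 2), Real.exp (-(K * r)) ∂(prior B p₀) := by
          rw [setIntegral_const, smul_eq_mul, mul_comm]
      _ ≤ ∫ θ in Metric.closedBall c (r / 2), Real.exp (g θ) ∂(prior B p₀) := by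
          refine setIntegral_mono_on (integrable_const _).integrableOn hint.integrableOn
            measurableSet_closedBall fun θ hθ => Real.exp_le_exp.2 ?_
          obtain ⟨h1, h2⟩ := hA θ hθ
          refine le_trans (neg_le_neg ?_) (hg θ h1)
          gcongr
      _ ≤ _ := setIntegral_le_integral hint (.of_forall fun θ => (Real.exp_pos _).le)
  refine le_trans (le_of_eq ?_) (Real.log_le_log (by positivity) hmain)
  have hsq : 0 < √(d : ℝ) := Real.sqrt_pos.2 hd0
  rw [Real.log_mul (by positivity) (by positivity), Real.log_mul (by positivity) (by positivity),
    Real.log_mul (by positivity) (by positivity), Real.log_exp, Real.log_exp, Real.log_pow,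
    Real.log_div hsq.ne' hKL.ne', Real.log_div hKL.ne' hsq.ne']
  have : K * r + L * r = d := by rw [hr]; field_simp; ring
  linear_combination this

/-! ### Lipschitz bounds for the loss -/

lemma logistic_sub_le (z z' : ℝ) : logistic z - logistic z' ≤ |z - z'| := by
  have h1 : 0 < 1 + Real.exp (-z) := by positivity
  have h2 : 0 < 1 + Real.exp (-z') := by positivity
  rw [logistic, logistic, sub_le_iff_le_add, ← Real.log_exp |z - z'|,
    ← Real.log_mul (Real.exp_ne_zero _) h2.ne']
  refine Real.log_le_log h1 ?_
  rw [mul_add, ← Real.exp_add, mul_one]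
  refine add_le_add (Real.one_le_exp (abs_nonneg _)) (Real.exp_le_exp.2 ?_)
  linarith [neg_le_abs (z - z')]

lemma abs_logistic_sub_le (z z' : ℝ) : |logistic z - logistic z'| ≤ |z - z'| :=
  abs_sub_le_iff.2 ⟨logistic_sub_le z z', abs_sub_comm z z' ▸ logistic_sub_le z' z⟩

lemma measurable_logistic : Measurable logistic := by
  unfold logistic; fun_prop

lemma abs_sgn (y : Bool) : |sgn y| = 1 := by cases y <;> simp [sgn]

/-- The loss of one round in terms of the feature vectors: `m θ` is the feature of the best arm
for `θ`, `w` the feature difference of the two arms and `v` the feature of the adversarial arm. -/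
def featureLoss {d : ℕ} (η μ : ℝ) (m : Vec d → Vec d) (w v : Vec d) (y : Bool) (θ : Vec d) : ℝ :=
  η * logistic (sgn y * inner ℝ θ w) - μ * inner ℝ θ (m θ - v)

section Round

variable {d : ℕ} {B : ℝ} {m : Vec d → Vec d}

/-- The feel-good term is a maximum of linear functions of `θ` with gradients of norm at most `2`;
comparing at the maximiser of one parameter avoids any regularity of `m`. -/
lemma abs_inner_argmax_sub_le (hm1 : ∀ θ, ‖m θ‖ ≤ 1)
    (hmax : ∀ θ θ', ‖θ‖ ≤ B → ‖θ'‖ ≤ B → inner ℝ θ' (m θ) ≤ inner ℝ θ' (m θ'))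
    {v θ θ' : Vec d} (hv : ‖v‖ ≤ 1) (hθ : ‖θ‖ ≤ B) (hθ' : ‖θ'‖ ≤ B) :
    |inner ℝ θ (m θ - v) - inner ℝ θ' (m θ' - v)| ≤ 2 * ‖θ - θ'‖ := by
  have key : ∀ a b : Vec d, ‖a‖ ≤ B → ‖b‖ ≤ B →
      inner ℝ a (m a - v) - inner ℝ b (m b - v) ≤ 2 * ‖a - b‖ := by
    intro a b ha hb
    have h1 := hmax a b ha hb
    have h2 : inner ℝ a (m a - v) - inner ℝ b (m b - v)
        = inner ℝ (a - b) (m a - v) + (inner ℝ b (m a) - inner ℝ b (m b)) := by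
      simp only [inner_sub_left, inner_sub_right]; ring
    have h3 := real_inner_le_norm (a - b) (m a - v)
    have h4 : ‖m a - v‖ ≤ 2 := (norm_sub_le _ _).trans (by linarith [hm1 a])
    have h5 : ‖a - b‖ * ‖m a - v‖ ≤ ‖a - b‖ * 2 := by gcongr
    linarith
  exact abs_sub_le_iff.2 ⟨key θ θ' hθ hθ', norm_sub_rev θ θ' ▸ key θ' θ hθ' hθ⟩

lemma abs_featureLoss_sub_le {η μ : ℝ} (hη : 0 ≤ η) (hμ : 0 ≤ μ) (hm1 : ∀ θ, ‖m θ‖ ≤ 1)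
    (hmax : ∀ θ θ', ‖θ‖ ≤ B → ‖θ'‖ ≤ B → inner ℝ θ' (m θ) ≤ inner ℝ θ' (m θ'))
    {v w θ θ' : Vec d} (hv : ‖v‖ ≤ 1) (hw : ‖w‖ ≤ 2) (y : Bool) (hθ : ‖θ‖ ≤ B) (hθ' : ‖θ'‖ ≤ B) :
    |featureLoss η μ m w v y θ - featureLoss η μ m w v y θ'| ≤ (2 * η + 2 * μ) * ‖θ - θ'‖ := by
  have h1 := abs_inner_argmax_sub_le hm1 hmax hv hθ hθ'
  have h2 := abs_logistic_sub_le (sgn y * inner ℝ θ w) (sgn y * inner ℝ θ' w)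
  rw [← mul_sub, abs_mul, abs_sgn, one_mul, ← inner_sub_left] at h2
  have h3 := abs_real_inner_le_norm (θ - θ') w
  have h4 : ‖θ - θ'‖ * ‖w‖ ≤ ‖θ - θ'‖ * 2 := by gcongr
  have h5 : featureLoss η μ m w v y θ - featureLoss η μ m w v y θ'
      = η * (logistic (sgn y * inner ℝ θ w) - logistic (sgn y * inner ℝ θ' w))
        - μ * (inner ℝ θ (m θ - v) - inner ℝ θ' (m θ' - v)) := by
    unfold featureLoss; ring
  rw [h5]
  refine (abs_sub _ _).trans ?_
  rw [abs_mul, abs_mul, abs_of_nonneg hη, abs_of_nonneg hμ]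
  have := mul_le_mul_of_nonneg_left (h2.trans (h3.trans h4)) hη
  have := mul_le_mul_of_nonneg_left h1 hμ
  linarith

lemma measurable_featureLoss {η μ : ℝ} (hm : Measurable m) (w v : Vec d) (y : Bool) :
    Measurable (featureLoss η μ m w v y) := by
  unfold featureLoss
  have := measurable_logistic
  fun_prop

/-! ### One round under a fixed sampling law -/

variable {q : Measure (Vec d)} [IsProbabilityMeasure q]

lemma integrable_inner_argmax_sub (hq : ∀ᵐ θ ∂q, ‖θ‖ ≤ B) (hm1 : ∀ θ, ‖m θ‖ ≤ 1)
    (hm : Measurable m) {v : Vec d} (hv : ‖v‖ ≤ 1) :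
    Integrable (fun θ => inner ℝ θ (m θ - v)) q := by
  refine Integrable.of_bound (by fun_prop) (B * 2) ?_
  filter_upwards [hq] with θ h
  have h4 : ‖m θ - v‖ ≤ 2 := (norm_sub_le _ _).trans (by linarith [hm1 θ])
  exact (norm_inner_le_norm _ _).trans
    (mul_le_mul h h4 (norm_nonneg _) ((norm_nonneg _).trans h))

lemma integrable_sq_inner_sub (hq : ∀ᵐ θ ∂q, ‖θ‖ ≤ B) {θs : Vec d} (hθs : ‖θs‖ ≤ B) (w : Vec d) :
    Integrable (fun θ => inner ℝ (θ - θs) w ^ 2) q := by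
  refine Integrable.of_bound (by fun_prop) ((2 * B * ‖w‖) ^ 2) ?_
  filter_upwards [hq] with θ h
  rw [norm_pow]
  refine pow_le_pow_left₀ (norm_nonneg _) ((norm_inner_le_norm _ _).trans ?_) 2
  gcongr
  exact (norm_sub_le _ _).trans (by linarith)

/-- The expected increment of the log-partition function in one round, averaged over the
preference, is bounded by the feel-good gain minus a multiple of the squared prediction error. -/
lemma mean_log_integral_exp_le {μ : ℝ} (hμ : 0 ≤ μ) (hμB : 8 * (μ * B) ≤ 1)
    (hm1 : ∀ θ, ‖m θ‖ ≤ 1) (hm : Measurable m)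
    (hmax : ∀ θ θ', ‖θ‖ ≤ B → ‖θ'‖ ≤ B → inner ℝ θ' (m θ) ≤ inner ℝ θ' (m θ'))
    (hq : ∀ᵐ θ ∂q, ‖θ‖ ≤ B) {θs v w : Vec d} (hθs : ‖θs‖ ≤ B) (hv : ‖v‖ ≤ 1) (hw : ‖w‖ ≤ 2) :
    1 / (1 + Real.exp (-inner ℝ θs w)) * Real.log (∫ θ, Real.exp
          (-(featureLoss (1 / 4) μ m w v true θ - featureLoss (1 / 4) μ m w v true θs)) ∂q)
      + (1 - 1 / (1 + Real.exp (-inner ℝ θs w))) * Real.log (∫ θ, Real.exp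
          (-(featureLoss (1 / 4) μ m w v false θ - featureLoss (1 / 4) μ m w v false θs)) ∂q)
      ≤ ∫ θ, (-(Real.exp (-(2 * B)) / 64) * inner ℝ (θ - θs) w ^ 2
          + μ * (inner ℝ θ (m θ - v) - inner ℝ θs (m θs - v)) + 32 * (μ * B) ^ 2) ∂q := by
  have hB : 0 ≤ B := (norm_nonneg _).trans hθs
  set p := 1 / (1 + Real.exp (-inner ℝ θs w)) with hp
  have hp0 : 0 ≤ p := by positivity
  have hp1 : 0 ≤ 1 - p := by
    rw [sub_nonneg, hp, div_le_one (by positivity)]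
    linarith [Real.exp_pos (-inner ℝ θs w)]
  have hint : ∀ y, Integrable (fun θ => Real.exp
      (-(featureLoss (1 / 4) μ m w v y θ - featureLoss (1 / 4) μ m w v y θs))) q := by
    intro y
    have := measurable_featureLoss (η := 1 / 4) (μ := μ) hm w v y
    refine Integrable.of_bound (by fun_prop) (Real.exp ((2 * (1 / 4) + 2 * μ) * (2 * B))) ?_
    filter_upwards [hq] with θ h
    rw [Real.norm_of_nonneg (Real.exp_pos _).le]
    refine Real.exp_le_exp.2 ((neg_le_abs _).trans
      ((abs_featureLoss_sub_le (by norm_num) hμ hm1 hmax hv hw y h hθs).trans ?_))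
    gcongr
    exact (norm_sub_le _ _).trans (by linarith)
  have hlog : ∀ y, Real.log (∫ θ, Real.exp
      (-(featureLoss (1 / 4) μ m w v y θ - featureLoss (1 / 4) μ m w v y θs)) ∂q)
      ≤ (∫ θ, Real.exp
      (-(featureLoss (1 / 4) μ m w v y θ - featureLoss (1 / 4) μ m w v y θs)) ∂q) - 1 :=
    fun y => Real.log_le_sub_one_of_pos (integral_exp_pos (hint y))
  refine (add_le_add (mul_le_mul_of_nonneg_left (hlog true) hp0)
    (mul_le_mul_of_nonneg_left (hlog false) hp1)).trans ?_
  -- After `log x ≤ x - 1` the bound is linear in the integrals, so the preference average can be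
  -- taken pointwise in `θ`.
  have hcomb : ∀ I J : ℝ, p * (I - 1) + (1 - p) * (J - 1) = p * I + (1 - p) * J - 1 := by
    intros; ring
  rw [hcomb, ← integral_const_mul, ← integral_const_mul,
    ← integral_add ((hint _).const_mul _) ((hint _).const_mul _)]
  have hJ : Integrable (fun θ => p * Real.exp
      (-(featureLoss (1 / 4) μ m w v true θ - featureLoss (1 / 4) μ m w v true θs))
      + (1 - p) * Real.exp
      (-(featureLoss (1 / 4) μ m w v false θ - featureLoss (1 / 4) μ m w v false θs))) q :=
    ((hint _).const_mul _).add ((hint _).const_mul _)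
  have hJ1 := integral_sub hJ (integrable_const (1 : ℝ))
  simp only [integral_const, probReal_univ, one_smul] at hJ1
  rw [← hJ1]
  refine integral_mono_ae (hJ.sub (integrable_const _)) ((((integrable_sq_inner_sub hq hθs w).const_mul _).add
      (((integrable_inner_argmax_sub hq hm1 hm hv).sub (integrable_const _)).const_mul _)).add
      (integrable_const _)) ?_
  filter_upwards [hq] with θ hθ
  have hbound : ∀ a : Vec d, ‖a‖ ≤ B → |inner ℝ a w| ≤ 2 * B := fun a ha =>
    (abs_real_inner_le_norm _ _).trans (by nlinarith [norm_nonneg a, norm_nonneg w])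
  have hell := hellinger_affinity_le (hbound θ hθ) (hbound θs hθs)
  rw [← hp, ← inner_sub_left] at hell
  set b := μ * (inner ℝ θ (m θ - v) - inner ℝ θs (m θs - v)) with hb
  have hbabs : |b| ≤ 4 * (μ * B) := by
    rw [hb, abs_mul, abs_of_nonneg hμ]
    have h1 := abs_inner_argmax_sub_le hm1 hmax hv hθ hθs
    have h2 : ‖θ - θs‖ ≤ 2 * B := (norm_sub_le _ _).trans (by linarith)
    calc _ ≤ μ * (2 * (2 * B)) := by gcongr; linarith
      _ = _ := by ring
  -- `hμB` is exactly what gives `|2 b| ≤ 1` here.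
  have hexp : Real.exp (2 * b) ≤ 1 + 2 * b + (2 * b) ^ 2 := by
    have := Real.abs_exp_sub_one_sub_id_le (x := 2 * b) (by
      rw [abs_mul, abs_two]; linarith)
    linarith [le_abs_self (Real.exp (2 * b) - 1 - 2 * b)]
  have hb2 : b ^ 2 ≤ 16 * (μ * B) ^ 2 := by
    have := pow_le_pow_left₀ (abs_nonneg b) hbabs 2
    rw [sq_abs] at this
    linarith
  -- Separates the likelihood from the feel-good term and doubles the weight `1/4` of the logistic
  -- loss to `1/2`, the Hellinger exponent. The factor `1/2` in front turns `1/32` into `1/64`.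
  have hamgm : ∀ A : ℝ, Real.exp (A / 2 + b) ≤ (Real.exp A + Real.exp (2 * b)) / 2 := by
    intro A
    have e1 : Real.exp A = Real.exp (A / 2) ^ 2 := by
      rw [← Real.exp_nat_mul]; congr 1; push_cast; ring
    have e2 : Real.exp (2 * b) = Real.exp b ^ 2 := by
      rw [← Real.exp_nat_mul]; congr 1
    rw [Real.exp_add, e1, e2]
    nlinarith [sq_nonneg (Real.exp (A / 2) - Real.exp b)]
  have e1 : -(featureLoss (1 / 4) μ m w v true θ - featureLoss (1 / 4) μ m w v true θs)
      = (-(1 / 2) * (logistic (inner ℝ θ w) - logistic (inner ℝ θs w))) / 2 + b := by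
    simp only [featureLoss, sgn, hb, if_true, one_mul]; ring
  have e2 : -(featureLoss (1 / 4) μ m w v false θ - featureLoss (1 / 4) μ m w v false θs)
      = (-(1 / 2) * (logistic (-inner ℝ θ w) - logistic (-inner ℝ θs w))) / 2 + b := by
    simp only [featureLoss, sgn, hb, Bool.false_eq_true, if_false, neg_one_mul]; ring
  rw [e1, e2]
  have g1 := mul_le_mul_of_nonneg_left
    (hamgm (-(1 / 2) * (logistic (inner ℝ θ w) - logistic (inner ℝ θs w)))) hp0
  have g2 := mul_le_mul_of_nonneg_left
    (hamgm (-(1 / 2) * (logistic (-inner ℝ θ w) - logistic (-inner ℝ θs w)))) hp1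
  linarith

/-- The one-round trade-off between the regret of one arm and the feel-good objective. -/
lemma integral_feelGood_add_regret_le {κ μ : ℝ} (hκ : 0 < κ) (hμ : 0 < μ) (hm1 : ∀ θ, ‖m θ‖ ≤ 1)
    (hm : Measurable m) (hq : ∀ᵐ θ ∂q, ‖θ‖ ≤ B) {f : Vec d → Vec d} (hf1 : ∀ θ, ‖f θ‖ ≤ 1)
    (hf : Measurable f) (hmf : ∀ θ, ‖θ‖ ≤ B → inner ℝ θ (m θ) = inner ℝ θ (f θ))
    {θs v : Vec d} (hθs : ‖θs‖ ≤ B) (hv : ‖v‖ ≤ 1) {e : ℝ} {h : Vec d → ℝ} (hh : Integrable h q)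
    (hle : ∀ θ, h θ ≤ ∫ θ', (-κ * inner ℝ (θ' - θs) (f θ - v) ^ 2
          + μ * (inner ℝ θ' (m θ' - v) - inner ℝ θs (m θs - v)) + e) ∂q) :
    ∫ θ, (h θ + μ * (inner ℝ θs (m θs) - inner ℝ θs (f θ))) ∂q ≤ d * μ ^ 2 / (4 * κ) + e := by
  have hB : 0 ≤ B := (norm_nonneg _).trans hθs
  have hfv : ∀ θ, ‖f θ - v‖ ≤ 2 := fun θ => (norm_sub_le _ _).trans (by linarith [hf1 θ])
  have hu : ∀ᵐ θ ∂q, ‖θ - θs‖ ≤ 2 * B := by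
    filter_upwards [hq] with θ hθ
    exact (norm_sub_le _ _).trans (by linarith)
  -- With `lam = κ / μ` the decoupled square cancels the negative quadratic term exactly.
  have hdec := integral_inner_le_decoupled (q := q) (u := fun θ => θ - θs) (w := fun θ => f θ - v)
    (lam := κ / μ) (by fun_prop) (by fun_prop) hu (.of_forall hfv) (by positivity)
  have hI := integrable_inner_argmax_sub hq hm1 hm hv
  have hJ : Integrable (fun θ => ∫ θ', inner ℝ (θ' - θs) (f θ - v) ^ 2 ∂q) q := by
    refine Integrable.of_bound (C := (2 * B * 2) ^ 2) ?_ (.of_forall fun θ => ?_)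
    · have : StronglyMeasurable fun p : Vec d × Vec d => inner ℝ (p.2 - θs) (f p.1 - v) ^ 2 := by
        refine Measurable.stronglyMeasurable ?_
        fun_prop
      exact this.integral_prod_right'.aestronglyMeasurable
    · refine (norm_integral_le_of_norm_le_const (C := (2 * B * 2) ^ 2) ?_).trans (by simp)
      filter_upwards [hu] with θ' hθ'
      rw [norm_pow]
      refine pow_le_pow_left₀ (norm_nonneg _) ((norm_inner_le_norm _ _).trans ?_) 2
      exact mul_le_mul hθ' (hfv θ) (norm_nonneg _) (by positivity)
  have hK : Integrable (fun θ => inner ℝ θs (f θ)) q := by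
    refine Integrable.of_bound (by fun_prop) (‖θs‖ * 1) (.of_forall fun θ => ?_)
    refine (norm_inner_le_norm _ _).trans ?_
    gcongr
    exact hf1 θ
  obtain ⟨G, hG⟩ : ∃ G, G = ∫ θ', (inner ℝ θ' (m θ' - v) - inner ℝ θs (m θs - v)) ∂q := ⟨_, rfl⟩
  have hle' : ∀ θ, h θ ≤ -κ * (∫ θ', inner ℝ (θ' - θs) (f θ - v) ^ 2 ∂q) + μ * G + e := by
    intro θ
    refine (hle θ).trans_eq ?_
    have i1 := (integrable_sq_inner_sub hq hθs (f θ - v)).const_mul (-κ)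
    have i2 : Integrable (fun θ' => μ * (inner ℝ θ' (m θ' - v) - inner ℝ θs (m θs - v))) q :=
      (hI.sub (integrable_const _)).const_mul _
    have i3 : Integrable (fun θ' => -κ * inner ℝ (θ' - θs) (f θ - v) ^ 2
      + μ * (inner ℝ θ' (m θ' - v) - inner ℝ θs (m θs - v))) q := i1.add i2
    rw [integral_add i3 (integrable_const _), integral_add i1 i2, integral_const_mul,
      integral_const_mul, hG]
    simp
  have hR : Integrable (fun θ => μ * (inner ℝ θs (m θs) - inner ℝ θs (f θ))) q :=
    ((integrable_const _).sub hK).const_mul _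
  have hstep : ∫ θ, (h θ + μ * (inner ℝ θs (m θs) - inner ℝ θs (f θ))) ∂q
      ≤ ∫ θ, ((-κ * (∫ θ', inner ℝ (θ' - θs) (f θ - v) ^ 2 ∂q) + μ * G + e)
          + μ * (inner ℝ θs (m θs) - inner ℝ θs (f θ))) ∂q := by
    refine integral_mono (hh.add hR) ((((hJ.const_mul _).add (integrable_const _)).add
      (integrable_const _)).add hR) fun θ => ?_
    have := hle' θ
    simp only
    linarith
  refine hstep.trans ?_
  have i1 : Integrable (fun θ => -κ * (∫ θ', inner ℝ (θ' - θs) (f θ - v) ^ 2 ∂q) + μ * G) q :=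
    (hJ.const_mul _).add (integrable_const _)
  have i2 : Integrable
      (fun θ => -κ * (∫ θ', inner ℝ (θ' - θs) (f θ - v) ^ 2 ∂q) + μ * G + e) q :=
    i1.add (integrable_const _)
  rw [integral_add i2 hR, integral_add i1 (integrable_const _),
    integral_add (hJ.const_mul _) (integrable_const _), integral_const_mul, integral_const_mul]
  simp only [integral_const, probReal_univ, one_smul]
  -- Since `θ` gets the same reward from `m θ` and `f θ`, gain and regret combine into the
  -- correlation of `θ - θs` with `f θ - v`.
  have hsum : G + ∫ θ, (inner ℝ θs (m θs) - inner ℝ θs (f θ)) ∂q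
      = ∫ θ, inner ℝ (θ - θs) (f θ - v) ∂q := by
    have i1 : Integrable (fun θ' => inner ℝ θ' (m θ' - v) - inner ℝ θs (m θs - v)) q :=
      hI.sub (integrable_const _)
    have i2 : Integrable (fun θ => inner ℝ θs (m θs) - inner ℝ θs (f θ)) q :=
      (integrable_const _).sub hK
    rw [hG, ← integral_add i1 i2]
    refine integral_congr_ae ?_
    filter_upwards [hq] with θ hθ
    have := hmf θ hθ
    simp only [inner_sub_left, inner_sub_right]
    linarith
  have h1 := mul_le_mul_of_nonneg_left hdec hμ.le
  rw [← hsum, mul_add, mul_add, ← integral_const_mul, ← mul_assoc, mul_div_cancel₀ _ hμ.ne'] at h1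
  have h2 : μ * (d / (4 * (κ / μ))) = d * μ ^ 2 / (4 * κ) := by
    field_simp
  linarith

end Round

/-! ### Conditioning and integration tools -/

lemma integral_eq_integral_condDistrib {Ω β Γ : Type*} [MeasurableSpace Ω] [MeasurableSpace β]
    [MeasurableSpace Γ] [StandardBorelSpace Γ] [Nonempty Γ] {P : Measure Ω}
    [IsProbabilityMeasure P] {U : Ω → β} {V : Ω → Γ} (hU : Measurable U) (hV : Measurable V)
    {F : β × Γ → ℝ} (hF : Measurable F) {C : ℝ} (hC : ∀ p, |F p| ≤ C) :
    ∫ ω, F (U ω, V ω) ∂P = ∫ ω, ∫ v, F (U ω, v) ∂(condDistrib V U P (U ω)) ∂P := by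
  have hint : Integrable (fun ω => F (U ω, V ω)) P :=
    Integrable.of_bound (hF.comp (hU.prodMk hV)).aestronglyMeasurable C (.of_forall fun ω => hC _)
  rw [← integral_condExp hU.comap_le]
  exact integral_congr_ae
    (condExp_prod_ae_eq_integral_condDistrib hU hV.aemeasurable hF.stronglyMeasurable hint)

lemma integral_bool {κ : Measure Bool} [IsProbabilityMeasure κ] {p : ℝ} (hp : 0 ≤ p)
    (h : κ {true} = ENNReal.ofReal p) (F : Bool → ℝ) :
    ∫ y, F y ∂κ = p * F true + (1 - p) * F false := by
  have h1 : κ.real {true} = p := by rw [Measure.real, h, ENNReal.toReal_ofReal hp]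
  have h2 : κ.real {false} = 1 - p := by
    rw [← h1, ← probReal_compl_eq_one_sub (MeasurableSet.singleton _)]
    congr 1
    ext b; cases b <;> simp
  rw [integral_fintype (Integrable.of_finite), Fintype.sum_bool, h1, h2, smul_eq_mul, smul_eq_mul]

/-- Excess losses are bounded on the prior ball, so this supplies both integrability of their
exponentials and bounds on the log increments. -/
lemma abs_log_integral_exp_le {α : Type*} [MeasurableSpace α] {q : Measure α}
    [IsProbabilityMeasure q] {h : α → ℝ} (hh : AEMeasurable h q) {C : ℝ}
    (hC : ∀ᵐ x ∂q, |h x| ≤ C) :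
    Integrable (fun x => Real.exp (h x)) q ∧ |Real.log (∫ x, Real.exp (h x) ∂q)| ≤ C := by
  have hint : Integrable (fun x => Real.exp (h x)) q := by
    refine Integrable.of_bound hh.exp.aestronglyMeasurable (Real.exp C) ?_
    filter_upwards [hC] with x hx
    rw [Real.norm_of_nonneg (Real.exp_pos _).le]
    exact Real.exp_le_exp.2 ((le_abs_self _).trans hx)
  have hup : ∫ x, Real.exp (h x) ∂q ≤ Real.exp C := by
    have := integral_mono_ae hint (integrable_const (Real.exp C)) (by
      filter_upwards [hC] with x hx
      exact Real.exp_le_exp.2 ((le_abs_self _).trans hx))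
    simpa using this
  have hlo : Real.exp (-C) ≤ ∫ x, Real.exp (h x) ∂q := by
    have := integral_mono_ae (integrable_const (Real.exp (-C))) hint (by
      filter_upwards [hC] with x hx
      exact Real.exp_le_exp.2 (neg_le_of_abs_le hx))
    simpa using this
  have hpos := (Real.exp_pos _).trans_le hlo
  exact ⟨hint, abs_le.2 ⟨(Real.le_log_iff_exp_le hpos).2 hlo, (Real.log_le_iff_le_exp hpos).2 hup⟩⟩

lemma iSup_subtype_eq_of_isMax {α : Type*} {A : Set α} {f : α → ℝ} {a : α} (ha : a ∈ A)
    (h : ∀ b ∈ A, f b ≤ f a) : ⨆ b : A, f b = f a := by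
  have : Nonempty A := ⟨⟨a, ha⟩⟩
  refine le_antisymm (ciSup_le fun b => h b b.2) ?_
  exact le_ciSup (f := fun b : A => f b) ⟨f a, by rintro _ ⟨b, rfl⟩; exact h b b.2⟩ ⟨a, ha⟩

/-! ### Posteriors, potential and its increments -/

section Run

variable {𝒳 𝒜 : Type*} {d : ℕ}

/-- The loss of a round, with the supremum over the action space replaced by the value at the
selected arm. -/
def selLoss (μ : ℝ) (φ : 𝒳 → 𝒜 → Vec d) (sel : ℕ → Fin 2 → 𝒳 → Vec d → 𝒜) (i : ℕ) (j : Fin 2)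
    (θ : Vec d) (r : Record 𝒳 𝒜) : ℝ :=
  featureLoss (1 / 4) μ (fun θ => φ r.1 (sel i 0 r.1 θ)) (φ r.1 (r.2.1 0) - φ r.1 (r.2.1 1))
    (φ r.1 (r.2.1 (1 - j))) r.2.2 θ

/-- The sum of the losses of the first `t` rounds. -/
def cumLoss (μ : ℝ) (φ : 𝒳 → 𝒜 → Vec d) (sel : ℕ → Fin 2 → 𝒳 → Vec d → 𝒜) (j : Fin 2) {t : ℕ}
    (S : Fin t → Record 𝒳 𝒜) (θ : Vec d) : ℝ :=
  ∑ i : Fin t, selLoss μ φ sel i j θ (S i)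

/-- The posterior expressed through `cumLoss`. -/
def post (μ B : ℝ) (p₀ : Vec d → ℝ) (φ : 𝒳 → 𝒜 → Vec d) (sel : ℕ → Fin 2 → 𝒳 → Vec d → 𝒜)
    (j : Fin 2) {t : ℕ} (S : Fin t → Record 𝒳 𝒜) : Measure (Vec d) :=
  (prior B p₀).tilted fun θ => -cumLoss μ φ sel j S θ

/-- The logarithm of the partition function, normalised by the loss of `θs`. -/
def logPartition (μ B : ℝ) (p₀ : Vec d → ℝ) (φ : 𝒳 → 𝒜 → Vec d)
    (sel : ℕ → Fin 2 → 𝒳 → Vec d → 𝒜) (θs : Vec d) (j : Fin 2) {t : ℕ}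
    (S : Fin t → Record 𝒳 𝒜) : ℝ :=
  Real.log (∫ θ, Real.exp (-(cumLoss μ φ sel j S θ - cumLoss μ φ sel j S θs)) ∂(prior B p₀))

/-- The increment of `logPartition` caused by the record `r`. -/
def logIncrement (μ B : ℝ) (p₀ : Vec d → ℝ) (φ : 𝒳 → 𝒜 → Vec d)
    (sel : ℕ → Fin 2 → 𝒳 → Vec d → 𝒜) (θs : Vec d) (j : Fin 2) {t : ℕ}
    (S : Fin t → Record 𝒳 𝒜) (r : Record 𝒳 𝒜) : ℝ :=
  Real.log (∫ θ, Real.exp (-(selLoss μ φ sel t j θ r - selLoss μ φ sel t j θs r))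
    ∂(post μ B p₀ φ sel j S))

/-- The increment averaged over the preference. -/
def meanIncrement (μ B : ℝ) (p₀ : Vec d → ℝ) (φ : 𝒳 → 𝒜 → Vec d)
    (sel : ℕ → Fin 2 → 𝒳 → Vec d → 𝒜) (θs : Vec d) (j : Fin 2) {t : ℕ}
    (S : Fin t → Record 𝒳 𝒜) (x : 𝒳) (a : Fin 2 → 𝒜) : ℝ :=
  btl φ θs x a * logIncrement μ B p₀ φ sel θs j S (x, a, true)
    + (1 - btl φ θs x a) * logIncrement μ B p₀ φ sel θs j S (x, a, false)

variable {μ B L : ℝ} {p₀ : Vec d → ℝ} {φ : 𝒳 → 𝒜 → Vec d} {act : ℕ → 𝒳 → Set 𝒜}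
  {sel : ℕ → Fin 2 → 𝒳 → Vec d → 𝒜} {θs : Vec d}

lemma ae_post_norm_le (j : Fin 2) {t : ℕ} (S : Fin t → Record 𝒳 𝒜) :
    ∀ᵐ θ ∂(post μ B p₀ φ sel j S), ‖θ‖ ≤ B :=
  (tilted_absolutelyContinuous _ _).ae_le (ae_prior_norm_le B p₀)

lemma btl_eq (φ : 𝒳 → 𝒜 → Vec d) (θs : Vec d) (x : 𝒳) (a : Fin 2 → 𝒜) :
    btl φ θs x a = 1 / (1 + Real.exp (-inner ℝ θs (φ x (a 0) - φ x (a 1)))) := by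
  have : Real.exp (-inner ℝ θs (φ x (a 0) - φ x (a 1)))
      = Real.exp (inner ℝ θs (φ x (a 1))) / Real.exp (inner ℝ θs (φ x (a 0))) := by
    rw [inner_sub_right, neg_sub, Real.exp_sub]
  rw [this, btl, reward, reward]
  field_simp

lemma btl_nonneg (φ : 𝒳 → 𝒜 → Vec d) (θs : Vec d) (x : 𝒳) (a : Fin 2 → 𝒜) :
    0 ≤ btl φ θs x a := by
  unfold btl; positivity

lemma btl_le_one (φ : 𝒳 → 𝒜 → Vec d) (θs : Vec d) (x : 𝒳) (a : Fin 2 → 𝒜) :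
    btl φ θs x a ≤ 1 := by
  unfold btl
  exact div_le_one_of_le₀ (le_add_of_nonneg_right (Real.exp_pos _).le) (by positivity)

lemma abs_reward_le (hφ1 : ∀ x a, ‖φ x a‖ ≤ 1) {θ : Vec d} (hθ : ‖θ‖ ≤ B) (x : 𝒳) (a : 𝒜) :
    |reward φ θ x a| ≤ B :=
  (abs_real_inner_le_norm _ _).trans
    ((mul_le_of_le_one_right (norm_nonneg _) (hφ1 x a)).trans hθ)

variable [MeasurableSpace 𝒳] [MeasurableSpace 𝒜]

lemma IsArgmaxRule.inner_le (h : IsArgmaxRule B φ act sel) (i : ℕ) (j k : Fin 2) (x : 𝒳)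
    (θ θ' : Vec d) (hθ : ‖θ‖ ≤ B) (hθ' : ‖θ'‖ ≤ B) :
    inner ℝ θ' (φ x (sel i j x θ)) ≤ inner ℝ θ' (φ x (sel i k x θ')) :=
  h.max i k x θ' hθ' _ (h.mem i j x θ hθ)

lemma IsArgmaxRule.maxReward_eq (h : IsArgmaxRule B φ act sel) (i : ℕ) (x : 𝒳)
    {θ : Vec d} (hθ : ‖θ‖ ≤ B) :
    maxReward φ (act i x) θ x = reward φ θ x (sel i 0 x θ) :=
  iSup_subtype_eq_of_isMax (f := fun a => reward φ θ x a) (h.mem i 0 x θ hθ) (h.max i 0 x θ hθ)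

/-- All maximisers give the same supremum, so the rule of sampler `0` can represent it for both
samplers, even if they break ties differently. Parameters outside the ball do not matter: the prior
does not charge them. -/
lemma IsArgmaxRule.loss_eq (h : IsArgmaxRule B φ act sel) (i : ℕ) (j : Fin 2) (r : Record 𝒳 𝒜)
    {θ : Vec d} (hθ : ‖θ‖ ≤ B) :
    loss (1 / 4) μ φ (act i r.1) j θ r = selLoss μ φ sel i j θ r := by
  rw [loss, selLoss, featureLoss, iSup_subtype_eq_of_isMax
    (f := fun a => inner ℝ θ (φ r.1 a - φ r.1 (r.2.1 (1 - j)))) (h.mem i 0 r.1 θ hθ)]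
  intro b hb
  have := h.max i 0 r.1 θ hθ b hb
  simp only [reward] at this
  simp only [inner_sub_right]
  linarith

lemma fgPosterior_eq_post (h : IsArgmaxRule B φ act sel) (j : Fin 2) {t : ℕ}
    (S : Fin t → Record 𝒳 𝒜) :
    fgPosterior (1 / 4) μ B p₀ φ act j S = post μ B p₀ φ sel j S := by
  refine tilted_congr ?_
  filter_upwards [ae_prior_norm_le B p₀] with θ hθ
  simp only [cumLoss, h.loss_eq _ _ _ hθ]

lemma abs_selLoss_sub_le (hμ : 0 ≤ μ) (hφ1 : ∀ x a, ‖φ x a‖ ≤ 1)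
    (h : IsArgmaxRule B φ act sel) (i : ℕ) (j : Fin 2) (r : Record 𝒳 𝒜) {θ θ' : Vec d}
    (hθ : ‖θ‖ ≤ B) (hθ' : ‖θ'‖ ≤ B) :
    |selLoss μ φ sel i j θ r - selLoss μ φ sel i j θ' r| ≤ (1 / 2 + 2 * μ) * ‖θ - θ'‖ := by
  have := abs_featureLoss_sub_le (η := 1 / 4) (by norm_num) hμ (fun θ => hφ1 _ _)
    (fun θ θ' hθ hθ' => h.inner_le i 0 0 r.1 θ θ' hθ hθ') (hφ1 r.1 (r.2.1 (1 - j)))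
    (w := φ r.1 (r.2.1 0) - φ r.1 (r.2.1 1))
    ((norm_sub_le _ _).trans (by linarith [hφ1 r.1 (r.2.1 0), hφ1 r.1 (r.2.1 1)])) r.2.2 hθ hθ'
  refine this.trans_eq ?_
  ring

lemma abs_cumLoss_sub_le (hμ : 0 ≤ μ) (hφ1 : ∀ x a, ‖φ x a‖ ≤ 1)
    (h : IsArgmaxRule B φ act sel) (j : Fin 2) {t : ℕ} (S : Fin t → Record 𝒳 𝒜) {θ θ' : Vec d}
    (hθ : ‖θ‖ ≤ B) (hθ' : ‖θ'‖ ≤ B) :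
    |cumLoss μ φ sel j S θ - cumLoss μ φ sel j S θ'| ≤ t * (1 / 2 + 2 * μ) * ‖θ - θ'‖ := by
  rw [cumLoss, cumLoss, ← Finset.sum_sub_distrib]
  refine (Finset.abs_sum_le_sum_abs _ _).trans
    ((Finset.sum_le_sum fun i _ => abs_selLoss_sub_le hμ hφ1 h _ j (S i) hθ hθ').trans_eq ?_)
  simp only [Finset.sum_const, Finset.card_univ, Fintype.card_fin, nsmul_eq_mul]
  ring

lemma measurable_selLoss (hφ : Measurable fun p : 𝒳 × 𝒜 => φ p.1 p.2)
    (h : IsArgmaxRule B φ act sel) (i : ℕ) (j : Fin 2) :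
    Measurable fun p : Record 𝒳 𝒜 × Vec d => selLoss μ φ sel i j p.2 p.1 := by
  have h0 : ∀ k : Fin 2, Measurable fun p : Record 𝒳 𝒜 × Vec d => φ p.1.1 (p.1.2.1 k) := fun k =>
    hφ.comp (measurable_fst.fst.prodMk ((measurable_pi_apply k).comp measurable_fst.snd.fst))
  have h1 : Measurable fun p : Record 𝒳 𝒜 × Vec d => φ p.1.1 (sel i 0 p.1.1 p.2) :=
    hφ.comp (measurable_fst.fst.prodMk
      ((h.measurable i 0).comp (measurable_fst.fst.prodMk measurable_snd)))
  have h2 : Measurable fun p : Record 𝒳 𝒜 × Vec d => sgn p.1.2.2 :=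
    (measurable_of_finite sgn).comp measurable_fst.snd.snd
  have h3 := measurable_logistic
  unfold selLoss featureLoss
  exact ((h3.comp (h2.mul (measurable_snd.inner ((h0 0).sub (h0 1))))).const_mul _).sub
    ((measurable_snd.inner (h1.sub (h0 _))).const_mul _)

lemma measurable_cumLoss (hφ : Measurable fun p : 𝒳 × 𝒜 => φ p.1 p.2)
    (h : IsArgmaxRule B φ act sel) (j : Fin 2) (t : ℕ) :
    Measurable fun p : (Fin t → Record 𝒳 𝒜) × Vec d => cumLoss μ φ sel j p.1 p.2 := by
  unfold cumLoss
  refine Finset.measurable_fun_sum _ fun i _ => ?_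
  have hi : Measurable fun p : (Fin t → Record 𝒳 𝒜) × Vec d => (p.1 i, p.2) :=
    ((measurable_pi_apply i).comp measurable_fst).prodMk measurable_snd
  have := Measurable.comp (g := fun p : Record 𝒳 𝒜 × Vec d => selLoss μ φ sel i j p.2 p.1)
    (measurable_selLoss hφ h i j) hi
  simpa only [Function.comp_def] using this

lemma measurable_cumLoss_right (hφ : Measurable fun p : 𝒳 × 𝒜 => φ p.1 p.2)
    (h : IsArgmaxRule B φ act sel) (j : Fin 2) {t : ℕ} (S : Fin t → Record 𝒳 𝒜) :
    Measurable (cumLoss μ φ sel j S) := by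
  have := Measurable.comp (g := fun p : (Fin t → Record 𝒳 𝒜) × Vec d => cumLoss μ φ sel j p.1 p.2)
    (measurable_cumLoss hφ h j t) (measurable_prodMk_left (x := S))
  simpa only [Function.comp_def] using this

lemma measurable_selLoss_right (hφ : Measurable fun p : 𝒳 × 𝒜 => φ p.1 p.2)
    (h : IsArgmaxRule B φ act sel) (i : ℕ) (j : Fin 2) (r : Record 𝒳 𝒜) :
    Measurable fun θ => selLoss μ φ sel i j θ r := by
  have := Measurable.comp (g := fun p : Record 𝒳 𝒜 × Vec d => selLoss μ φ sel i j p.2 p.1)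
    (measurable_selLoss hφ h i j) (measurable_prodMk_left (x := r))
  simpa only [Function.comp_def] using this

lemma integrable_exp_neg_cumLoss_sub (hμ : 0 ≤ μ) (hp : IsLipschitzPrior B L p₀)
    (hφ : Measurable fun p : 𝒳 × 𝒜 => φ p.1 p.2)
    (hφ1 : ∀ x a, ‖φ x a‖ ≤ 1) (hθs : ‖θs‖ ≤ B)
    (h : IsArgmaxRule B φ act sel) (j : Fin 2) {t : ℕ} (S : Fin t → Record 𝒳 𝒜) :
    Integrable (fun θ => Real.exp (-(cumLoss μ φ sel j S θ - cumLoss μ φ sel j S θs)))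
      (prior B p₀) := by
  have := hp.isProb
  refine (abs_log_integral_exp_le (C := t * (1 / 2 + 2 * μ) * (2 * B))
    ((measurable_cumLoss_right hφ h j S).sub_const _).neg.aemeasurable ?_).1
  filter_upwards [ae_prior_norm_le B p₀] with θ hθ
  rw [Pi.neg_apply, abs_neg]
  refine (abs_cumLoss_sub_le hμ hφ1 h j S hθ hθs).trans ?_
  gcongr
  exact (norm_sub_le _ _).trans (by linarith)

lemma integrable_exp_neg_cumLoss (hμ : 0 ≤ μ) (hp : IsLipschitzPrior B L p₀)
    (hφ : Measurable fun p : 𝒳 × 𝒜 => φ p.1 p.2)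
    (hφ1 : ∀ x a, ‖φ x a‖ ≤ 1) (hθs : ‖θs‖ ≤ B)
    (h : IsArgmaxRule B φ act sel) (j : Fin 2) {t : ℕ} (S : Fin t → Record 𝒳 𝒜) :
    Integrable (fun θ => Real.exp (-cumLoss μ φ sel j S θ)) (prior B p₀) := by
  have := (integrable_exp_neg_cumLoss_sub hμ hp hφ hφ1 hθs h j S).const_mul
    (Real.exp (-cumLoss μ φ sel j S θs))
  refine this.congr (.of_forall fun θ => ?_)
  simp only
  rw [← Real.exp_add]
  congr 1; ring

lemma isProbabilityMeasure_post (hμ : 0 ≤ μ) (hp : IsLipschitzPrior B L p₀)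
    (hφ : Measurable fun p : 𝒳 × 𝒜 => φ p.1 p.2)
    (hφ1 : ∀ x a, ‖φ x a‖ ≤ 1) (hθs : ‖θs‖ ≤ B)
    (h : IsArgmaxRule B φ act sel) (j : Fin 2) {t : ℕ} (S : Fin t → Record 𝒳 𝒜) :
    IsProbabilityMeasure (post μ B p₀ φ sel j S) := by
  have := hp.isProb
  exact isProbabilityMeasure_tilted (integrable_exp_neg_cumLoss hμ hp hφ hφ1 hθs h j S)

lemma logIncrement_bound (hμ : 0 ≤ μ) (hp : IsLipschitzPrior B L p₀)
    (hφ : Measurable fun p : 𝒳 × 𝒜 => φ p.1 p.2)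
    (hφ1 : ∀ x a, ‖φ x a‖ ≤ 1) (hθs : ‖θs‖ ≤ B)
    (h : IsArgmaxRule B φ act sel) (j : Fin 2) {t : ℕ} (S : Fin t → Record 𝒳 𝒜)
    (r : Record 𝒳 𝒜) :
    Integrable (fun θ => Real.exp (-(selLoss μ φ sel t j θ r - selLoss μ φ sel t j θs r)))
      (post μ B p₀ φ sel j S) ∧
    |logIncrement μ B p₀ φ sel θs j S r| ≤ (1 / 2 + 2 * μ) * (2 * B) := by
  have := isProbabilityMeasure_post hμ hp hφ hφ1 hθs h j S
  refine abs_log_integral_exp_le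
    ((measurable_selLoss_right hφ h t j r).sub_const _).neg.aemeasurable ?_
  filter_upwards [ae_post_norm_le j S] with θ hθ
  rw [Pi.neg_apply, abs_neg]
  refine (abs_selLoss_sub_le hμ hφ1 h t j r hθ hθs).trans ?_
  gcongr
  exact (norm_sub_le _ _).trans (by linarith)

lemma measurable_logIncrement (hφ : Measurable fun p : 𝒳 × 𝒜 => φ p.1 p.2)
    (hp : IsLipschitzPrior B L p₀) (h : IsArgmaxRule B φ act sel) (j : Fin 2) (t : ℕ) :
    Measurable fun p : (Fin t → Record 𝒳 𝒜) × Record 𝒳 𝒜 =>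
      logIncrement μ B p₀ φ sel θs j p.1 p.2 := by
  have := hp.isProb
  unfold logIncrement post
  -- A posterior integral is a quotient of two prior integrals depending on the history as a
  -- parameter, so measurability of `post` as a kernel is not needed.
  simp only [integral_exp_tilted]
  have hc := measurable_cumLoss (μ := μ) hφ h j t
  have hs := measurable_selLoss (μ := μ) hφ h t j
  have m1 : Measurable fun p : ((Fin t → Record 𝒳 𝒜) × Record 𝒳 𝒜) × Vec d =>
      Real.exp (-cumLoss μ φ sel j p.1.1 p.2) :=
    (hc.comp (measurable_fst.fst.prodMk measurable_snd)).neg.exp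
  have m2 : Measurable fun p : ((Fin t → Record 𝒳 𝒜) × Record 𝒳 𝒜) × Vec d =>
      Real.exp (((fun θ => -cumLoss μ φ sel j p.1.1 θ)
        + fun θ => -(selLoss μ φ sel t j θ p.1.2 - selLoss μ φ sel t j θs p.1.2)) p.2) :=
    ((hc.comp (measurable_fst.fst.prodMk measurable_snd)).neg.add
      ((hs.comp (measurable_fst.snd.prodMk measurable_snd)).sub
        (hs.comp (measurable_fst.snd.prodMk measurable_const))).neg).exp
  exact (m2.stronglyMeasurable.integral_prod_right'.measurable.div
    m1.stronglyMeasurable.integral_prod_right'.measurable).log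

/-- The posterior is the normalised tilt of the prior, so the ratio of consecutive partition
functions is a posterior mean. -/
lemma logPartition_succ (hμ : 0 ≤ μ) (hp : IsLipschitzPrior B L p₀)
    (hφ : Measurable fun p : 𝒳 × 𝒜 => φ p.1 p.2)
    (hφ1 : ∀ x a, ‖φ x a‖ ≤ 1) (hθs : ‖θs‖ ≤ B)
    (h : IsArgmaxRule B φ act sel) (j : Fin 2) {t : ℕ} (S : Fin (t + 1) → Record 𝒳 𝒜) :
    logPartition μ B p₀ φ sel θs j S
      = logPartition μ B p₀ φ sel θs j (fun i : Fin t => S i.castSucc)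
        + logIncrement μ B p₀ φ sel θs j (fun i : Fin t => S i.castSucc) (S (Fin.last t)) := by
  have := hp.isProb
  set S' : Fin t → Record 𝒳 𝒜 := fun i => S i.castSucc with hS'
  have hcum : ∀ θ, cumLoss μ φ sel j S θ
      = cumLoss μ φ sel j S' θ + selLoss μ φ sel t j θ (S (Fin.last t)) := fun θ => by
    simp only [cumLoss, Fin.sum_univ_castSucc, Fin.val_castSucc, Fin.val_last, hS']
  have hI := integral_exp_pos (integrable_exp_neg_cumLoss_sub hμ hp hφ hφ1 hθs h j S')
  have hI' := integral_exp_pos (integrable_exp_neg_cumLoss hμ hp hφ hφ1 hθs h j S')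
  have := isProbabilityMeasure_post hμ hp hφ hφ1 hθs h j S'
  have hJ := integral_exp_pos (logIncrement_bound hμ hp hφ hφ1 hθs h j S' (S (Fin.last t))).1
  rw [logPartition, logPartition, logIncrement, ← Real.log_mul hI.ne' hJ.ne']
  congr 1
  have e1 : ∫ θ, Real.exp (-(cumLoss μ φ sel j S' θ - cumLoss μ φ sel j S' θs)) ∂(prior B p₀)
      = Real.exp (cumLoss μ φ sel j S' θs)
        * ∫ θ, Real.exp (-cumLoss μ φ sel j S' θ) ∂(prior B p₀) := by
    rw [← integral_const_mul]
    congr 1; ext θ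
    rw [← Real.exp_add]; congr 1; ring
  rw [post, integral_exp_tilted, e1, mul_assoc, mul_div_cancel₀ _ hI'.ne', ← integral_const_mul]
  congr 1; ext θ
  rw [← Real.exp_add, hcum, hcum]
  congr 1
  simp only [Pi.add_apply]
  ring

lemma measurable_reward (hφ : Measurable fun p : 𝒳 × 𝒜 => φ p.1 p.2) (θ : Vec d) :
    Measurable fun p : 𝒳 × 𝒜 => reward φ θ p.1 p.2 :=
  measurable_const.inner hφ

lemma measurable_meanIncrement (hφ : Measurable fun p : 𝒳 × 𝒜 => φ p.1 p.2)
    (hp : IsLipschitzPrior B L p₀) (h : IsArgmaxRule B φ act sel) (j : Fin 2) (t : ℕ) :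
    Measurable fun p : (Fin t → Record 𝒳 𝒜) × 𝒳 × (Fin 2 → 𝒜) =>
      meanIncrement μ B p₀ φ sel θs j p.1 p.2.1 p.2.2 := by
  have hr : ∀ k : Fin 2, Measurable fun p : (Fin t → Record 𝒳 𝒜) × 𝒳 × (Fin 2 → 𝒜) =>
      reward φ θs p.2.1 (p.2.2 k) := fun k => (measurable_reward hφ θs).comp
    (measurable_snd.fst.prodMk ((measurable_pi_apply k).comp measurable_snd.snd))
  have hb : Measurable fun p : (Fin t → Record 𝒳 𝒜) × 𝒳 × (Fin 2 → 𝒜) =>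
      btl φ θs p.2.1 p.2.2 := (hr 0).exp.div ((hr 0).exp.add (hr 1).exp)
  have hi : ∀ y : Bool, Measurable fun p : (Fin t → Record 𝒳 𝒜) × 𝒳 × (Fin 2 → 𝒜) =>
      logIncrement μ B p₀ φ sel θs j p.1 (p.2.1, p.2.2, y) := fun y => by
    have hy : Measurable fun p : (Fin t → Record 𝒳 𝒜) × 𝒳 × (Fin 2 → 𝒜) =>
        (p.1, ((p.2.1, p.2.2, y) : Record 𝒳 𝒜)) := measurable_fst.prodMk
      (measurable_snd.fst.prodMk (measurable_snd.snd.prodMk measurable_const))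
    have := Measurable.comp (g := fun p : (Fin t → Record 𝒳 𝒜) × Record 𝒳 𝒜 =>
      logIncrement μ B p₀ φ sel θs j p.1 p.2) (measurable_logIncrement hφ hp h j t) hy
    simpa only [Function.comp_def] using this
  unfold meanIncrement
  exact (hb.mul (hi true)).add ((hb.const_sub 1).mul (hi false))

lemma abs_meanIncrement_le (hμ : 0 ≤ μ) (hp : IsLipschitzPrior B L p₀)
    (hφ : Measurable fun p : 𝒳 × 𝒜 => φ p.1 p.2)
    (hφ1 : ∀ x a, ‖φ x a‖ ≤ 1) (hθs : ‖θs‖ ≤ B)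
    (h : IsArgmaxRule B φ act sel) (j : Fin 2) {t : ℕ} (S : Fin t → Record 𝒳 𝒜) (x : 𝒳)
    (a : Fin 2 → 𝒜) :
    |meanIncrement μ B p₀ φ sel θs j S x a| ≤ (1 / 2 + 2 * μ) * (2 * B) := by
  have h1 := (logIncrement_bound hμ hp hφ hφ1 hθs h j S (x, a, true)).2
  have h2 := (logIncrement_bound hμ hp hφ hφ1 hθs h j S (x, a, false)).2
  have hb0 := btl_nonneg φ θs x a
  have hb1 := sub_nonneg.2 (btl_le_one φ θs x a)
  refine (abs_add_le _ _).trans ?_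
  rw [abs_mul, abs_mul, abs_of_nonneg hb0, abs_of_nonneg hb1]
  nlinarith [mul_le_mul_of_nonneg_left h1 hb0, mul_le_mul_of_nonneg_left h2 hb1]

/-- The conditional one-round inequality, given the past and the arm of the other sampler. -/
lemma integral_meanIncrement_add_le (hμ : 0 < μ) (hμB : 8 * (μ * B) ≤ 1)
    (hp : IsLipschitzPrior B L p₀) (hφ : Measurable fun p : 𝒳 × 𝒜 => φ p.1 p.2)
    (hφ1 : ∀ x a, ‖φ x a‖ ≤ 1) (hθs : ‖θs‖ ≤ B)
    (h : IsArgmaxRule B φ act sel) (j : Fin 2) {t : ℕ} (S : Fin t → Record 𝒳 𝒜) (x : 𝒳)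
    (b : 𝒜) {a : Vec d → Fin 2 → 𝒜} (ha : Measurable a) (haj : ∀ θ, a θ j = sel t j x θ)
    (hab : ∀ θ, a θ (1 - j) = b) :
    ∫ θ, (meanIncrement μ B p₀ φ sel θs j S x (a θ)
        + μ * (reward φ θs x (sel t 0 x θs) - reward φ θs x (a θ j))) ∂(post μ B p₀ φ sel j S)
      ≤ 16 * Real.exp (2 * B) * d * μ ^ 2 + 32 * (μ * B) ^ 2 := by
  have := isProbabilityMeasure_post hμ.le hp hφ hφ1 hθs h j S
  have hq := ae_post_norm_le (μ := μ) (B := B) (p₀ := p₀) (φ := φ) (sel := sel) j S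
  have hφx : ∀ k, Measurable fun θ => φ x (sel t k x θ) := fun k =>
    hφ.comp (measurable_const.prodMk
      ((h.measurable t k).comp (measurable_const.prodMk measurable_id)))
  have hint : Integrable (fun θ => meanIncrement μ B p₀ φ sel θs j S x (a θ))
      (post μ B p₀ φ sel j S) :=
    Integrable.of_bound ((measurable_meanIncrement hφ hp h j t).comp
      (measurable_const.prodMk (measurable_const.prodMk ha))).aestronglyMeasurable _
      (.of_forall fun θ => abs_meanIncrement_le hμ.le hp hφ hφ1 hθs h j S x _)
  have hmain := integral_feelGood_add_regret_le (q := post μ B p₀ φ sel j S)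
    (m := fun θ => φ x (sel t 0 x θ)) (f := fun θ => φ x (sel t j x θ)) (v := φ x b)
    (κ := Real.exp (-(2 * B)) / 64) (e := 32 * (μ * B) ^ 2) (by positivity) hμ
    (fun θ => hφ1 _ _) (hφx 0) hq (fun θ => hφ1 _ _) (hφx j)
    (fun θ hθ => le_antisymm (h.inner_le t 0 j x θ θ hθ hθ) (h.inner_le t j 0 x θ θ hθ hθ))
    hθs (hφ1 x b) hint (fun θ => ?_)
  · simp only [haj]
    refine hmain.trans_eq ?_
    rw [Real.exp_neg]
    field_simp
    ring
  · have hw : ‖φ x (a θ 0) - φ x (a θ 1)‖ ≤ 2 :=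
      (norm_sub_le _ _).trans (by linarith [hφ1 x (a θ 0), hφ1 x (a θ 1)])
    have hle := mean_log_integral_exp_le (q := post μ B p₀ φ sel j S)
      (m := fun θ => φ x (sel t 0 x θ)) hμ.le hμB (fun θ => hφ1 _ _) (hφx 0)
      (fun θ θ' hθ hθ' => h.inner_le t 0 0 x θ θ' hθ hθ') hq hθs (hφ1 x b) hw
    -- For `j = 1` the feature difference has the opposite sign, which the square ignores.
    have hsq : ∀ u : Vec d, inner ℝ u (φ x (a θ 0) - φ x (a θ 1)) ^ 2
        = inner ℝ u (φ x (sel t j x θ) - φ x b) ^ 2 := by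
      intro u
      rw [← haj, ← hab θ]
      fin_cases j
      · rfl
      · change _ = inner ℝ u (φ x (a θ 1) - φ x (a θ 0)) ^ 2
        simp only [inner_sub_right]
        ring
    simp only [hsq] at hle
    rw [meanIncrement, btl_eq]
    simp only [logIncrement, selLoss, hab]
    exact hle

end Run

/-- Nonnegativity of `c` covers the non-integrable case, where the integral is `0` by convention. -/
lemma integral_le_of_ae_le {α : Type*} [MeasurableSpace α] {q : Measure α}
    [IsProbabilityMeasure q] {g : α → ℝ} {c : ℝ} (hc : 0 ≤ c) (h : ∀ᵐ x ∂q, g x ≤ c) :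
    ∫ x, g x ∂q ≤ c := by
  by_cases hg : Integrable g q
  · have := integral_mono_ae hg (integrable_const c) h
    simpa using this
  · rwa [integral_undef hg]

/-! ### Summing the potential over the rounds -/

section Run

variable {𝒳 𝒜 Ω : Type*} {d : ℕ} [MeasurableSpace 𝒳] [MeasurableSpace 𝒜] [MeasurableSpace Ω]
  {P : Measure Ω} [IsProbabilityMeasure P] {T : ℕ} {η μ B L : ℝ} {p₀ : Vec d → ℝ}
  {φ : 𝒳 → 𝒜 → Vec d} {act : ℕ → 𝒳 → Set 𝒜} {sel : ℕ → Fin 2 → 𝒳 → Vec d → 𝒜} {θs : Vec d}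
  {X : ℕ → Ω → 𝒳} {θ : ℕ → Fin 2 → Ω → Vec d} {Y : ℕ → Ω → Bool}

lemma IsRun.measurable_arms (hrun : IsRun P T η μ B p₀ φ act θs sel X θ Y)
    (h : IsArgmaxRule B φ act sel) {t : ℕ} (ht : t < T) : Measurable (arms sel X θ t) :=
  measurable_pi_iff.2 fun j =>
    (h.measurable t j).comp ((hrun.measurable_X t ht).prodMk (hrun.measurable_θ t ht j))

lemma IsRun.measurable_hist (hrun : IsRun P T η μ B p₀ φ act θs sel X θ Y)
    (h : IsArgmaxRule B φ act sel) {t : ℕ} (ht : t ≤ T) : Measurable (hist sel X θ Y t) :=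
  measurable_pi_iff.2 fun i => by
    have hi : (i : ℕ) < T := i.2.trans_le ht
    exact (hrun.measurable_X i hi).prodMk ((hrun.measurable_arms h hi).prodMk
      (hrun.measurable_Y i hi))

/-- The two arms selected by a pair of parameters. -/
def pairArms (sel : ℕ → Fin 2 → 𝒳 → Vec d → 𝒜) (t : ℕ) (x : 𝒳) (p : Vec d × Vec d) : Fin 2 → 𝒜 :=
  fun i => sel t i x (if i = 0 then p.1 else p.2)

lemma measurable_pairArms (h : IsArgmaxRule B φ act sel) (t : ℕ) :
    Measurable fun p : 𝒳 × (Vec d × Vec d) => pairArms sel t p.1 p.2 := by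
  refine measurable_pi_iff.2 fun i => ?_
  have hi : Measurable fun p : 𝒳 × (Vec d × Vec d) => if i = 0 then p.2.1 else p.2.2 := by
    split_ifs
    · exact measurable_snd.fst
    · exact measurable_snd.snd
  exact (h.measurable t i).comp (measurable_fst.prodMk hi)

/-- Averaging the increment over the preference. -/
lemma IsRun.integral_logIncrement (hrun : IsRun P T (1 / 4) μ B p₀ φ act θs sel X θ Y)
    (hμ : 0 ≤ μ) (hp : IsLipschitzPrior B L p₀) (hφ : Measurable fun p : 𝒳 × 𝒜 => φ p.1 p.2)
    (hφ1 : ∀ x a, ‖φ x a‖ ≤ 1) (hθs : ‖θs‖ ≤ B)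
    (h : IsArgmaxRule B φ act sel) (j : Fin 2) {t : ℕ} (ht : t < T) :
    ∫ ω, logIncrement μ B p₀ φ sel θs j (hist sel X θ Y t ω)
        (X t ω, arms sel X θ t ω, Y t ω) ∂P
      = ∫ ω, meanIncrement μ B p₀ φ sel θs j (hist sel X θ Y t ω) (X t ω)
        (arms sel X θ t ω) ∂P := by
  have hU : Measurable fun ω => (hist sel X θ Y t ω, X t ω, arms sel X θ t ω) :=
    (hrun.measurable_hist h ht.le).prodMk
      ((hrun.measurable_X t ht).prodMk (hrun.measurable_arms h ht))
  have hr : Measurable fun p : ((Fin t → Record 𝒳 𝒜) × 𝒳 × (Fin 2 → 𝒜)) × Bool =>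
      (p.1.1, ((p.1.2.1, p.1.2.2, p.2) : Record 𝒳 𝒜)) :=
    measurable_fst.fst.prodMk (measurable_fst.snd.fst.prodMk
      (measurable_fst.snd.snd.prodMk measurable_snd))
  have hF := Measurable.comp (g := fun p : (Fin t → Record 𝒳 𝒜) × Record 𝒳 𝒜 =>
    logIncrement μ B p₀ φ sel θs j p.1 p.2) (measurable_logIncrement hφ hp h j t) hr
  have key := integral_eq_integral_condDistrib (P := P) hU (hrun.measurable_Y t ht) hF
    (fun p => (logIncrement_bound hμ hp hφ hφ1 hθs h j _ _).2)
  simp only [Function.comp_def] at key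
  rw [key]
  refine integral_congr_ae ?_
  filter_upwards [hrun.preference t ht] with ω hω
  exact integral_bool (btl_nonneg φ θs _ _) hω _

/-- Averaging over the sampled parameters: one round of the potential argument. -/
lemma IsRun.integral_step_le (hrun : IsRun P T (1 / 4) μ B p₀ φ act θs sel X θ Y)
    (hμ : 0 < μ) (hμB : 8 * (μ * B) ≤ 1) (hp : IsLipschitzPrior B L p₀)
    (hφ : Measurable fun p : 𝒳 × 𝒜 => φ p.1 p.2)
    (hφ1 : ∀ x a, ‖φ x a‖ ≤ 1) (hθs : ‖θs‖ ≤ B)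
    (h : IsArgmaxRule B φ act sel) (j : Fin 2) {t : ℕ} (ht : t < T) :
    ∫ ω, (meanIncrement μ B p₀ φ sel θs j (hist sel X θ Y t ω) (X t ω) (arms sel X θ t ω)
        + μ * (reward φ θs (X t ω) (sel t 0 (X t ω) θs)
          - reward φ θs (X t ω) (arms sel X θ t ω j))) ∂P
      ≤ 16 * Real.exp (2 * B) * d * μ ^ 2 + 32 * (μ * B) ^ 2 := by
  set ε := 16 * Real.exp (2 * B) * d * μ ^ 2 + 32 * (μ * B) ^ 2 with hε
  have hε0 : 0 ≤ ε := by positivity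
  have hU : Measurable fun ω => (hist sel X θ Y t ω, X t ω) :=
    (hrun.measurable_hist h ht.le).prodMk (hrun.measurable_X t ht)
  have hV : Measurable fun ω => (θ t 0 ω, θ t 1 ω) :=
    (hrun.measurable_θ t ht 0).prodMk (hrun.measurable_θ t ht 1)
  let F : ((Fin t → Record 𝒳 𝒜) × 𝒳) × (Vec d × Vec d) → ℝ := fun p =>
    meanIncrement μ B p₀ φ sel θs j p.1.1 p.1.2 (pairArms sel t p.1.2 p.2)
      + μ * (reward φ θs p.1.2 (sel t 0 p.1.2 θs) - reward φ θs p.1.2 (pairArms sel t p.1.2 p.2 j))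
  have hpair : Measurable fun p : ((Fin t → Record 𝒳 𝒜) × 𝒳) × (Vec d × Vec d) =>
      pairArms sel t p.1.2 p.2 :=
    (measurable_pairArms h t).comp (measurable_fst.snd.prodMk measurable_snd)
  have hF : Measurable F := by
    have h1 := Measurable.comp (g := fun p : (Fin t → Record 𝒳 𝒜) × 𝒳 × (Fin 2 → 𝒜) =>
      meanIncrement μ B p₀ φ sel θs j p.1 p.2.1 p.2.2) (measurable_meanIncrement hφ hp h j t)
      (measurable_fst.fst.prodMk (measurable_fst.snd.prodMk hpair))
    have h2 : Measurable fun p : ((Fin t → Record 𝒳 𝒜) × 𝒳) × (Vec d × Vec d) =>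
        reward φ θs p.1.2 (sel t 0 p.1.2 θs) :=
      (measurable_reward hφ θs).comp (measurable_fst.snd.prodMk
        ((h.measurable t 0).comp (measurable_fst.snd.prodMk measurable_const)))
    have h3 : Measurable fun p : ((Fin t → Record 𝒳 𝒜) × 𝒳) × (Vec d × Vec d) =>
        reward φ θs p.1.2 (pairArms sel t p.1.2 p.2 j) :=
      (measurable_reward hφ θs).comp (measurable_fst.snd.prodMk
        ((measurable_pi_apply j).comp hpair))
    exact h1.add ((h2.sub h3).const_mul μ)
  have hFC : ∀ p, |F p| ≤ (1 / 2 + 2 * μ) * (2 * B) + μ * (B + B) := fun p => by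
    refine (abs_add_le _ _).trans (add_le_add (abs_meanIncrement_le hμ.le hp hφ hφ1 hθs h j _ _ _) ?_)
    rw [abs_mul, abs_of_pos hμ]
    exact mul_le_mul_of_nonneg_left ((abs_sub _ _).trans
      (add_le_add (abs_reward_le hφ1 hθs _ _) (abs_reward_le hφ1 hθs _ _))) hμ.le
  have harms : ∀ ω, arms sel X θ t ω = pairArms sel t (X t ω) (θ t 0 ω, θ t 1 ω) := fun ω => by
    funext i; fin_cases i <;> rfl
  have key := integral_eq_integral_condDistrib (P := P) hU hV hF hFC
  simp only [harms]
  refine key.trans_le (integral_le_of_ae_le hε0 ?_)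
  filter_upwards [hrun.sample t ht] with ω hω
  rw [hω, fgPosterior_eq_post h, fgPosterior_eq_post h]
  generalize hist sel X θ Y t ω = S
  generalize X t ω = x
  have hP : ∀ k, IsProbabilityMeasure (post μ B p₀ φ sel k S) :=
    fun k => isProbabilityMeasure_post hμ.le hp hφ hφ1 hθs h k S
  have h0 := hP 0
  have h1 := hP 1
  have hFx : Measurable fun v => F ((S, x), v) := hF.comp measurable_prodMk_left
  have hFint : Integrable (fun v => F ((S, x), v))
      ((post μ B p₀ φ sel 0 S).prod (post μ B p₀ φ sel 1 S)) :=
    Integrable.of_bound hFx.aestronglyMeasurable _ (.of_forall fun v => hFC _)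
  have hpx : Measurable (pairArms sel t x) :=
    (measurable_pairArms h t).comp (measurable_prodMk_left (x := x))
  -- By conditional independence the sampling law is a product. The parameter of sampler `j` is
  -- integrated innermost, with the opponent's arm frozen.
  have hcases : j = 0 ∨ j = 1 := by fin_cases j <;> simp
  rcases hcases with rfl | rfl
  · rw [integral_prod_symm _ hFint]
    refine integral_le_of_ae_le hε0 (.of_forall fun θ₁ => ?_)
    exact integral_meanIncrement_add_le hμ hμB hp hφ hφ1 hθs h 0 S x (sel t 1 x θ₁)
      (a := fun θ₀ => pairArms sel t x (θ₀, θ₁)) (hpx.comp measurable_prodMk_right)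
      (fun _ => rfl) (fun _ => rfl)
  · rw [integral_prod _ hFint]
    refine integral_le_of_ae_le hε0 (.of_forall fun θ₀ => ?_)
    exact integral_meanIncrement_add_le hμ hμB hp hφ hφ1 hθs h 1 S x (sel t 0 x θ₀)
      (a := fun θ₁ => pairArms sel t x (θ₀, θ₁)) (hpx.comp measurable_prodMk_left)
      (fun _ => rfl) (fun _ => rfl)

lemma logPartition_hist (hμ : 0 ≤ μ) (hp : IsLipschitzPrior B L p₀)
    (hφ : Measurable fun p : 𝒳 × 𝒜 => φ p.1 p.2)
    (hφ1 : ∀ x a, ‖φ x a‖ ≤ 1) (hθs : ‖θs‖ ≤ B)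
    (h : IsArgmaxRule B φ act sel) (j : Fin 2) {Ω' : Type*}
    (X : ℕ → Ω' → 𝒳) (θ : ℕ → Fin 2 → Ω' → Vec d) (Y : ℕ → Ω' → Bool) (T : ℕ) (ω : Ω') :
    logPartition μ B p₀ φ sel θs j (hist sel X θ Y T ω)
      = ∑ t ∈ Finset.range T, logIncrement μ B p₀ φ sel θs j (hist sel X θ Y t ω)
        (X t ω, arms sel X θ t ω, Y t ω) := by
  have := hp.isProb
  induction T with
  | zero => simp [logPartition, cumLoss]
  | succ t ih =>
    rw [Finset.sum_range_succ, ← ih, logPartition_succ hμ hp hφ hφ1 hθs h]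
    rfl

/-- The lower bound on the partition function. -/
lemma le_logPartition (hμ : 0 ≤ μ) (hp : IsLipschitzPrior B L p₀)
    (hφ : Measurable fun p : 𝒳 × 𝒜 => φ p.1 p.2)
    (hφ1 : ∀ x a, ‖φ x a‖ ≤ 1) (hθs : ‖θs‖ ≤ B) (h : IsArgmaxRule B φ act sel)
    (hd : 1 ≤ d) (hT : 1 ≤ T) (hB : 0 < B) (hL : 0 ≤ L)
    (hdK : d ≤ 2 * B * (L + T * (1 / 2 + 2 * μ))) (j : Fin 2) (S : Fin T → Record 𝒳 𝒜) :
    Real.log (p₀ θs) - d - d * Real.log ((L + T * (1 / 2 + 2 * μ)) / √d)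
      ≤ logPartition μ B p₀ φ sel θs j S := by
  have hT0 : (0 : ℝ) < T := by exact_mod_cast hT
  refine hp.le_log_integral_exp hd hB hL (by positivity) hθs (fun θ hθ => ?_)
    (integrable_exp_neg_cumLoss_sub hμ hp hφ hφ1 hθs h j S) hdK
  exact neg_le_neg ((le_abs_self _).trans (abs_cumLoss_sub_le hμ hφ1 h j S hθ hθs))

lemma IsRun.integrable_reward (hrun : IsRun P T η μ B p₀ φ act θs sel X θ Y)
    (hφ : Measurable fun p : 𝒳 × 𝒜 => φ p.1 p.2)
    (hφ1 : ∀ x a, ‖φ x a‖ ≤ 1) (hθs : ‖θs‖ ≤ B) (h : IsArgmaxRule B φ act sel)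
    {t : ℕ} (ht : t < T) :
    Integrable (fun ω => reward φ θs (X t ω) (sel t 0 (X t ω) θs)) P ∧
      ∀ j, Integrable (fun ω => reward φ θs (X t ω) (arms sel X θ t ω j)) P := by
  have hX := hrun.measurable_X t ht
  have h1 : Measurable fun ω => reward φ θs (X t ω) (sel t 0 (X t ω) θs) :=
    (measurable_reward hφ θs).comp
      (hX.prodMk ((h.measurable t 0).comp (hX.prodMk measurable_const)))
  have h2 : ∀ j, Measurable fun ω => reward φ θs (X t ω) (arms sel X θ t ω j) := fun j =>
    (measurable_reward hφ θs).comp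
      (hX.prodMk ((measurable_pi_apply j).comp (hrun.measurable_arms h ht)))
  exact ⟨Integrable.of_bound h1.aestronglyMeasurable B
      (.of_forall fun ω => abs_reward_le hφ1 hθs _ _),
    fun j => Integrable.of_bound (h2 j).aestronglyMeasurable B
      (.of_forall fun ω => abs_reward_le hφ1 hθs _ _)⟩

/-- The cumulative regret of the arms of one sampler. -/
lemma IsRun.sum_integral_regret_le (hrun : IsRun P T (1 / 4) μ B p₀ φ act θs sel X θ Y)
    (hμ : 0 < μ) (hμB : 8 * (μ * B) ≤ 1) (hp : IsLipschitzPrior B L p₀)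
    (hφ : Measurable fun p : 𝒳 × 𝒜 => φ p.1 p.2)
    (hφ1 : ∀ x a, ‖φ x a‖ ≤ 1) (hθs : ‖θs‖ ≤ B) (h : IsArgmaxRule B φ act sel)
    (hd : 1 ≤ d) (hT : 1 ≤ T) (hB : 0 < B) (hL : 0 ≤ L)
    (hdK : d ≤ 2 * B * (L + T * (1 / 2 + 2 * μ))) (j : Fin 2) :
    μ * ∑ t ∈ Finset.range T, ∫ ω, (reward φ θs (X t ω) (sel t 0 (X t ω) θs)
          - reward φ θs (X t ω) (arms sel X θ t ω j)) ∂P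
      ≤ T * (16 * Real.exp (2 * B) * d * μ ^ 2 + 32 * (μ * B) ^ 2)
        - (Real.log (p₀ θs) - d - d * Real.log ((L + T * (1 / 2 + 2 * μ)) / √d)) := by
  have hlogInt : ∀ t ∈ Finset.range T, Integrable (fun ω => logIncrement μ B p₀ φ sel θs j
      (hist sel X θ Y t ω) (X t ω, arms sel X θ t ω, Y t ω)) P := by
    intro t ht
    rw [Finset.mem_range] at ht
    have hm := Measurable.comp (g := fun p : (Fin t → Record 𝒳 𝒜) × Record 𝒳 𝒜 =>
      logIncrement μ B p₀ φ sel θs j p.1 p.2) (measurable_logIncrement hφ hp h j t)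
      ((hrun.measurable_hist h ht.le).prodMk ((hrun.measurable_X t ht).prodMk
        ((hrun.measurable_arms h ht).prodMk (hrun.measurable_Y t ht))))
    exact Integrable.of_bound hm.aestronglyMeasurable _
      (.of_forall fun ω => (logIncrement_bound hμ.le hp hφ hφ1 hθs h j _ _).2)
  have hmeanInt : ∀ t < T, Integrable (fun ω => meanIncrement μ B p₀ φ sel θs j
      (hist sel X θ Y t ω) (X t ω) (arms sel X θ t ω)) P := by
    intro t ht
    have hm := Measurable.comp (g := fun p : (Fin t → Record 𝒳 𝒜) × 𝒳 × (Fin 2 → 𝒜) =>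
      meanIncrement μ B p₀ φ sel θs j p.1 p.2.1 p.2.2) (measurable_meanIncrement hφ hp h j t)
      ((hrun.measurable_hist h ht.le).prodMk ((hrun.measurable_X t ht).prodMk
        (hrun.measurable_arms h ht)))
    exact Integrable.of_bound hm.aestronglyMeasurable _
      (.of_forall fun ω => abs_meanIncrement_le hμ.le hp hφ hφ1 hθs h j _ _ _)
  have hregInt : ∀ t < T, Integrable (fun ω => reward φ θs (X t ω) (sel t 0 (X t ω) θs)
      - reward φ θs (X t ω) (arms sel X θ t ω j)) P := by
    intro t ht
    obtain ⟨h1, h2⟩ := hrun.integrable_reward hφ hφ1 hθs h ht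
    exact h1.sub (h2 j)
  have hlow : Real.log (p₀ θs) - d - d * Real.log ((L + T * (1 / 2 + 2 * μ)) / √d)
      ≤ ∑ t ∈ Finset.range T, ∫ ω, logIncrement μ B p₀ φ sel θs j
      (hist sel X θ Y t ω) (X t ω, arms sel X θ t ω, Y t ω) ∂P := by
    rw [← integral_finsetSum _ hlogInt]
    have := integral_mono (μ := P) (f := fun _ => Real.log (p₀ θs) - d
      - d * Real.log ((L + T * (1 / 2 + 2 * μ)) / √d)) (integrable_const _)
      (integrable_finsetSum _ hlogInt) (fun ω => ?_)
    · rwa [integral_const, probReal_univ, one_smul] at this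
    · simp only
      rw [← logPartition_hist hμ.le hp hφ hφ1 hθs h j X θ Y T ω]
      exact le_logPartition hμ.le hp hφ hφ1 hθs h hd hT hB hL hdK j _
  have hsum := Finset.sum_le_sum fun t (ht : t ∈ Finset.range T) =>
    hrun.integral_step_le hμ hμB hp hφ hφ1 hθs h j (Finset.mem_range.1 ht)
  rw [Finset.sum_const, Finset.card_range, nsmul_eq_mul] at hsum
  have hsplit : ∑ t ∈ Finset.range T, ∫ ω, (meanIncrement μ B p₀ φ sel θs j
        (hist sel X θ Y t ω) (X t ω) (arms sel X θ t ω)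
        + μ * (reward φ θs (X t ω) (sel t 0 (X t ω) θs)
          - reward φ θs (X t ω) (arms sel X θ t ω j))) ∂P
      = ∑ t ∈ Finset.range T, ∫ ω, logIncrement μ B p₀ φ sel θs j
      (hist sel X θ Y t ω) (X t ω, arms sel X θ t ω, Y t ω) ∂P
      + μ * ∑ t ∈ Finset.range T, ∫ ω, (reward φ θs (X t ω) (sel t 0 (X t ω) θs)
          - reward φ θs (X t ω) (arms sel X θ t ω j)) ∂P := by
    rw [Finset.mul_sum, ← Finset.sum_add_distrib]
    refine Finset.sum_congr rfl fun t ht => ?_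
    rw [Finset.mem_range] at ht
    rw [integral_add (hmeanInt t ht) ((hregInt t ht).const_mul μ), integral_const_mul,
      hrun.integral_logIncrement hμ.le hp hφ hφ1 hθs h j ht]
  linarith

end Run

/-! ### Regret bounds -/

section Run

variable {𝒳 𝒜 Ω : Type*} {d : ℕ} [MeasurableSpace 𝒳] [MeasurableSpace 𝒜] [MeasurableSpace Ω]
  {P : Measure Ω} [IsProbabilityMeasure P] {T : ℕ} {η μ B L : ℝ} {p₀ : Vec d → ℝ}
  {φ : 𝒳 → 𝒜 → Vec d} {act : ℕ → 𝒳 → Set 𝒜} {sel : ℕ → Fin 2 → 𝒳 → Vec d → 𝒜} {θs : Vec d}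
  {X : ℕ → Ω → 𝒳} {θ : ℕ → Fin 2 → Ω → Vec d} {Y : ℕ → Ω → Bool}

lemma IsRun.integral_regret (hrun : IsRun P T η μ B p₀ φ act θs sel X θ Y)
    (hφ : Measurable fun p : 𝒳 × 𝒜 => φ p.1 p.2)
    (hφ1 : ∀ x a, ‖φ x a‖ ≤ 1) (hθs : ‖θs‖ ≤ B) (h : IsArgmaxRule B φ act sel) :
    Integrable (regret φ act θs sel X θ T) P ∧
    ∫ ω, regret φ act θs sel X θ T ω ∂P
      = (∑ t ∈ Finset.range T, ∫ ω, (reward φ θs (X t ω) (sel t 0 (X t ω) θs)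
          - reward φ θs (X t ω) (arms sel X θ t ω 0)) ∂P) / 2
        + (∑ t ∈ Finset.range T, ∫ ω, (reward φ θs (X t ω) (sel t 0 (X t ω) θs)
          - reward φ θs (X t ω) (arms sel X θ t ω 1)) ∂P) / 2 := by
  have hint : ∀ t ∈ Finset.range T, ∀ j, Integrable (fun ω =>
      reward φ θs (X t ω) (sel t 0 (X t ω) θs) - reward φ θs (X t ω) (arms sel X θ t ω j)) P := by
    intro t ht j
    obtain ⟨h1, h2⟩ := hrun.integrable_reward hφ hφ1 hθs h (Finset.mem_range.1 ht)
    exact h1.sub (h2 j)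
  have hreg : ∀ ω, regret φ act θs sel X θ T ω = ∑ t ∈ Finset.range T,
      ((reward φ θs (X t ω) (sel t 0 (X t ω) θs) - reward φ θs (X t ω) (arms sel X θ t ω 0)) / 2
      + (reward φ θs (X t ω) (sel t 0 (X t ω) θs)
        - reward φ θs (X t ω) (arms sel X θ t ω 1)) / 2) := by
    intro ω
    refine Finset.sum_congr rfl fun t _ => ?_
    rw [h.maxReward_eq t (X t ω) hθs]
    ring
  have hint2 : ∀ t ∈ Finset.range T, Integrable (fun ω =>
      (reward φ θs (X t ω) (sel t 0 (X t ω) θs) - reward φ θs (X t ω) (arms sel X θ t ω 0)) / 2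
      + (reward φ θs (X t ω) (sel t 0 (X t ω) θs)
        - reward φ θs (X t ω) (arms sel X θ t ω 1)) / 2) P :=
    fun t ht => ((hint t ht 0).div_const 2).add ((hint t ht 1).div_const 2)
  refine ⟨(integrable_finsetSum _ hint2).congr (.of_forall fun ω => (hreg ω).symm), ?_⟩
  simp only [hreg]
  rw [integral_finsetSum _ hint2, ← add_div, ← Finset.sum_add_distrib, Finset.sum_div]
  refine Finset.sum_congr rfl fun t ht => ?_
  rw [integral_add ((hint t ht 0).div_const 2) ((hint t ht 1).div_const 2), integral_div,
    integral_div, add_div]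

lemma IsRun.integral_regret_le_trivial (hrun : IsRun P T η μ B p₀ φ act θs sel X θ Y)
    (hφ : Measurable fun p : 𝒳 × 𝒜 => φ p.1 p.2)
    (hφ1 : ∀ x a, ‖φ x a‖ ≤ 1) (hθs : ‖θs‖ ≤ B) (h : IsArgmaxRule B φ act sel) :
    ∫ ω, regret φ act θs sel X θ T ω ∂P ≤ 2 * B * T := by
  have hB : 0 ≤ B := (norm_nonneg _).trans hθs
  rw [(hrun.integral_regret hφ hφ1 hθs h).2]
  have hj : ∀ j, ∑ t ∈ Finset.range T, ∫ ω, (reward φ θs (X t ω) (sel t 0 (X t ω) θs)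
      - reward φ θs (X t ω) (arms sel X θ t ω j)) ∂P ≤ T * (2 * B) := by
    intro j
    refine (Finset.sum_le_sum fun t _ => integral_le_of_ae_le (c := 2 * B) (by positivity)
      (.of_forall fun ω => ?_)).trans_eq (by simp)
    have h1 := (abs_le.1 (abs_reward_le hφ1 hθs (X t ω) (sel t 0 (X t ω) θs))).2
    have h2 := (abs_le.1 (abs_reward_le hφ1 hθs (X t ω) (arms sel X θ t ω j))).1
    linarith
  have h0 := hj 0
  have h1 := hj 1
  linarith

/-- The explicit regret bound. -/
lemma IsRun.integral_regret_le
    (hrun : IsRun P T (1 / 4) (1 / (10 * Real.exp B * √T)) B p₀ φ act θs sel X θ Y)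
    (hp : IsLipschitzPrior B L p₀) (hφ : Measurable fun p : 𝒳 × 𝒜 => φ p.1 p.2)
    (hφ1 : ∀ x a, ‖φ x a‖ ≤ 1) (hθs : ‖θs‖ ≤ B) (h : IsArgmaxRule B φ act sel)
    (hd : 1 ≤ d) (hT : 1 ≤ T) (hB : 0 < B) (hL : 0 ≤ L)
    (hdK : (d : ℝ) ≤ 2 * B * (L + √T / (5 * Real.exp B) + T / 2)) :
    ∫ ω, regret φ act θs sel X θ T ω ∂P
      ≤ 10 * Real.exp B * d * √T * (2 - Real.log (p₀ θs) / d
        + Real.log (L / √d + 1 / (5 * Real.exp B) * √(T / d) + T / (2 * √d))) := by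
  have hd0 : (0 : ℝ) < d := by exact_mod_cast hd
  have hd1 : (1 : ℝ) ≤ d := by exact_mod_cast hd
  have hT0 : (0 : ℝ) < T := by exact_mod_cast hT
  have hT1 : (1 : ℝ) ≤ T := by exact_mod_cast hT
  have hs1 : 1 ≤ √(T : ℝ) := Real.one_le_sqrt.2 hT1
  have hs2 : √(T : ℝ) ^ 2 = T := Real.sq_sqrt hT0.le
  have hsd : 0 < √(d : ℝ) := Real.sqrt_pos.2 hd0
  have hE : B + 1 ≤ Real.exp B := Real.add_one_le_exp B
  have hE2 : Real.exp (2 * B) = Real.exp B ^ 2 := by rw [← Real.exp_nat_mul]; norm_num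
  set E := Real.exp B with hEdef
  set s := √(T : ℝ) with hsdef
  have hE0 : 0 < E := Real.exp_pos B
  have hs0 : 0 < s := by linarith
  obtain ⟨μ, hμdef⟩ : ∃ μ, μ = 1 / (10 * E * s) := ⟨_, rfl⟩
  rw [← hμdef] at hrun
  have hμ : 0 < μ := hμdef ▸ by positivity
  have hμB : 8 * (μ * B) ≤ 1 := by
    rw [hμdef, one_div_mul_eq_div, ← mul_div_assoc, div_le_one (by positivity)]
    nlinarith
  have hK : L + T * (1 / 2 + 2 * μ) = L + s / (5 * E) + T / 2 := by
    rw [hμdef, ← hs2]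
    field_simp
    ring
  have hK' : (L + T * (1 / 2 + 2 * μ)) / √d
      = L / √d + 1 / (5 * E) * √(T / d) + T / (2 * √d) := by
    rw [hK, Real.sqrt_div hT0.le, ← hsdef]
    field_simp
  have hbound : ∀ j, _ := fun j => hrun.sum_integral_regret_le hμ hμB hp hφ hφ1 hθs h hd hT hB hL
    (by rwa [hK]) j
  -- With `T μ² = 1 / (100 E²)` and `B ≤ E`, the errors total at most `(16 d + 32) / 100`, below
  -- `d`.
  have hε : T * (16 * Real.exp (2 * B) * d * μ ^ 2 + 32 * (μ * B) ^ 2) ≤ d := by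
    have hTμ : T * μ ^ 2 = 1 / (100 * E ^ 2) := by
      rw [hμdef, ← hs2]
      field_simp
      norm_num
    have hBE : B ^ 2 ≤ E ^ 2 := by gcongr; linarith
    have e1 : T * (16 * Real.exp (2 * B) * d * μ ^ 2 + 32 * (μ * B) ^ 2)
        = (16 * E ^ 2 * d + 32 * B ^ 2) * (T * μ ^ 2) := by rw [hE2]; ring
    rw [e1, hTμ, mul_one_div, div_le_iff₀ (by positivity)]
    nlinarith [mul_le_mul_of_nonneg_right hd1 (sq_nonneg E)]
  rw [(hrun.integral_regret hφ hφ1 hθs h).2]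
  have h0 := hbound 0
  have h1 := hbound 1
  rw [hK'] at h0 h1
  set R0 := ∑ t ∈ Finset.range T, ∫ ω, (reward φ θs (X t ω) (sel t 0 (X t ω) θs)
      - reward φ θs (X t ω) (arms sel X θ t ω 0)) ∂P
  set R1 := ∑ t ∈ Finset.range T, ∫ ω, (reward φ θs (X t ω) (sel t 0 (X t ω) θs)
      - reward φ θs (X t ω) (arms sel X θ t ω 1)) ∂P
  set ell := Real.log (L / √d + 1 / (5 * E) * √(T / d) + T / (2 * √d))
  have hsum : μ * (R0 / 2 + R1 / 2) ≤ 2 * d - Real.log (p₀ θs) + d * ell := by linarith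
  have hrhs : 10 * E * d * s * (2 - Real.log (p₀ θs) / d + ell)
      = (2 * d - Real.log (p₀ θs) + d * ell) / μ := by
    rw [hμdef]
    field_simp
  rw [hrhs, le_div_iff₀ hμ]
  linarith

/-- The order of the regret, with constants depending on `B` and `L` only. -/
lemma IsRun.integral_regret_le_order
    (hrun : IsRun P T (1 / 4) (1 / (10 * Real.exp B * √T)) B p₀ φ act θs sel X θ Y)
    (hp : IsLipschitzPrior B L p₀) (hφ : Measurable fun p : 𝒳 × 𝒜 => φ p.1 p.2)
    (hφ1 : ∀ x a, ‖φ x a‖ ≤ 1) (hθs : ‖θs‖ ≤ B) (h : IsArgmaxRule B φ act sel)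
    (hd : 1 ≤ d) (hT : 1 ≤ T) (hB : 0 < B) (hL : 0 ≤ L) :
    ∫ ω, regret φ act θs sel X θ T ω ∂P
      ≤ 10 * Real.exp B * (2 + 2 * B * L + |Real.log (2 * B)| + Real.log (L + 2)) * (d * √T)
        * (1 + Real.log (d * T)) := by
  have hd0 : (0 : ℝ) < d := by exact_mod_cast hd
  have hd1 : (1 : ℝ) ≤ d := by exact_mod_cast hd
  have hT0 : (0 : ℝ) < T := by exact_mod_cast hT
  have hT1 : (1 : ℝ) ≤ T := by exact_mod_cast hT
  have hs1 : 1 ≤ √(T : ℝ) := Real.one_le_sqrt.2 hT1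
  have hE : B + 1 ≤ Real.exp B := Real.add_one_le_exp B
  have hlogd : 0 ≤ Real.log d := Real.log_nonneg hd1
  have hlogT : 0 ≤ Real.log T := Real.log_nonneg hT1
  have hlogL : 0 ≤ Real.log (L + 2) := Real.log_nonneg (by linarith)
  have hBL : 0 ≤ B * L := by positivity
  have habs := abs_nonneg (Real.log (2 * B))
  rw [Real.log_mul hd0.ne' hT0.ne']
  obtain ⟨C, hC⟩ : ∃ C, C = 2 + 2 * B * L + |Real.log (2 * B)| + Real.log (L + 2) := ⟨_, rfl⟩
  have hC2 : 2 ≤ C := by rw [hC]; linarith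
  rw [← hC]
  -- Either the explicit bound applies, or `d` exceeds `B T` and the trivial bound `2 B T` is below
  -- `2 d √T`.
  rcases le_or_gt (d : ℝ) (2 * B * (L + √T / (5 * Real.exp B) + T / 2)) with hdK | hdK
  · have hmain := hrun.integral_regret_le hp hφ hφ1 hθs h hd hT hB hL hdK
    have hp0 : -Real.log (p₀ θs) / d ≤ 2 * B * L + |Real.log (2 * B)| := by
      rw [div_le_iff₀ hd0]
      have := hp.neg_log_le hB hL hθs
      have := mul_le_mul_of_nonneg_left (le_abs_self (Real.log (2 * B))) hd0.le
      nlinarith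
    have hlog : Real.log (L / √d + 1 / (5 * Real.exp B) * √(T / d) + T / (2 * √d))
        ≤ Real.log (L + 2) + Real.log T := by
      have hsd : 1 ≤ √(d : ℝ) := Real.one_le_sqrt.2 hd1
      rw [← Real.log_mul (by linarith) hT0.ne']
      refine Real.log_le_log (by positivity) ?_
      have e1 : L / √d ≤ L * T :=
        (div_le_self hL hsd).trans (le_mul_of_one_le_right hL hT1)
      have e2 : 1 / (5 * Real.exp B) * √(T / d) ≤ 1 * T := by
        refine mul_le_mul ?_ ?_ (Real.sqrt_nonneg _) zero_le_one
        · rw [div_le_one (by positivity)]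
          linarith
        · refine Real.sqrt_le_iff.2 ⟨hT0.le, (div_le_self hT0.le hd1).trans ?_⟩
          nlinarith
      have e3 : T / (2 * √(d : ℝ)) ≤ T := div_le_self hT0.le (by linarith)
      linarith
    refine hmain.trans ?_
    have hbr : 2 - Real.log (p₀ θs) / d
        + Real.log (L / √d + 1 / (5 * Real.exp B) * √(T / d) + T / (2 * √d))
        ≤ C * (1 + (Real.log d + Real.log T)) := by
      -- Uses `1 ≤ C` to absorb `log T`.
      have : C + Real.log T ≤ C * (1 + (Real.log d + Real.log T)) := by nlinarith
      rw [neg_div] at hp0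
      linarith
    calc _ ≤ 10 * Real.exp B * d * √T * (C * (1 + (Real.log d + Real.log T))) := by gcongr
      _ = _ := by ring
  · have hBT : B * T < d := by
      refine lt_of_le_of_lt ?_ hdK
      have : 0 ≤ √T / (5 * Real.exp B) := by positivity
      nlinarith
    have htriv := hrun.integral_regret_le_trivial hφ hφ1 hθs h
    have hds : (d : ℝ) ≤ d * √T := le_mul_of_one_le_right hd0.le hs1
    have h20 : 2 ≤ 10 * Real.exp B * C := by nlinarith
    have hone : 1 ≤ 1 + (Real.log d + Real.log T) := by linarith
    calc _ ≤ 2 * B * T := htriv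
      _ ≤ 2 * (d * √T) * 1 := by linarith
      _ ≤ _ := by gcongr

end Run

end DuelingBandit

end

theorem theorem1 (B L : ℝ) (hB : 0 < B) (hL : 0 ≤ L) :
    ∃ (C : ℝ) (k : ℕ), ∀ (𝒳 𝒜 Ω : Type*) [MeasurableSpace 𝒳] [MeasurableSpace 𝒜]
      [MeasurableSpace Ω] (P : Measure Ω) [IsProbabilityMeasure P] (d T : ℕ)
      (φ : 𝒳 → 𝒜 → DuelingBandit.Vec d) (act : ℕ → 𝒳 → Set 𝒜)
      (θs : DuelingBandit.Vec d) (p₀ : DuelingBandit.Vec d → ℝ)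
      (sel : ℕ → Fin 2 → 𝒳 → DuelingBandit.Vec d → 𝒜)
      (X : ℕ → Ω → 𝒳) (θ : ℕ → Fin 2 → Ω → DuelingBandit.Vec d) (Y : ℕ → Ω → Bool),
      1 ≤ d → 1 ≤ T →
      (Measurable fun p : 𝒳 × 𝒜 => φ p.1 p.2) → (∀ x a, ‖φ x a‖ ≤ 1) → ‖θs‖ ≤ B →
      DuelingBandit.IsLipschitzPrior B L p₀ →
      DuelingBandit.IsArgmaxRule B φ act sel →
      DuelingBandit.IsRun P T 0.25 (1 / (10 * Real.exp B * √T)) B p₀ φ act θs sel X θ Y →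
      Integrable (DuelingBandit.regret φ act θs sel X θ T) P ∧
      ∫ ω, DuelingBandit.regret φ act θs sel X θ T ω ∂P
        ≤ C * (d * √T) * (1 + Real.log (d * T)) ^ k ∧
      ((d : ℝ) ≤ 2 * B * (L + √T / (5 * Real.exp B) + T / 2) →
        ∫ ω, DuelingBandit.regret φ act θs sel X θ T ω ∂P
          ≤ 10 * Real.exp B * d * √T *
            (2 - Real.log (p₀ θs) / d
              + Real.log (L / √d + 1 / (5 * Real.exp B) * √(T / d) + T / (2 * √d)))) := by
  -- One logarithmic factor suffices, so `k = 1`.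
  refine ⟨10 * Real.exp B * (2 + 2 * B * L + |Real.log (2 * B)| + Real.log (L + 2)), 1, ?_⟩
  intro 𝒳 𝒜 Ω _ _ _ P _ d T φ act θs p₀ sel X θ Y hd hT hφ hφ1 hθs hp h hrun
  rw [show (0.25 : ℝ) = 1 / 4 by norm_num] at hrun
  refine ⟨(hrun.integral_regret hφ hφ1 hθs h).1, ?_, fun hdK =>
    hrun.integral_regret_le hp hφ hφ1 hθs h hd hT hB hL hdK⟩
  rw [pow_one]
  exact hrun.integral_regret_le_order hp hφ hφ1 hθs h hd hT hB hL
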